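/- Fix integers $n,m\ge 0$. A contact set $N=(c_1,\dots,c_m)$ on $\mathbb R^n$ (velocities in coordinates in which the kinetic energy is $\tfrac12\|v\|_2^2$) assigns to each contact $c$ a normal row $J_{n,c}\in\mathbb R^{1\times n}$, a tangential Jacobian $J_{t,c}\in\mathbb R^{2\times n}$ and a friction coefficient $\mu_c\ge 0$ ($\mu_c=0$ meaning that $c$ is frictionless). Put $\mathrm{Unit}(u)=\{u/\|u\|_2\}$ for $u\ne 0$, let $\mathrm{Unit}(0)$ be the closed unit disc of $\mathbb R^2$, and set $$A_c=\{v: J_{n,c}v<0\},\quad F_c(v)=J_{n,c}^T-\mu_cJ_{t,c}^T\,\mathrm{Unit}(J_{t,c}v),\quad A_N=\bigcup_{c\in N}A_c,\quad I_N=\operatorname{int}(\mathbb R^n\setminus A_N),$$ $$F_N(v)=\operatorname{hull}\{f: f\in F_c(v)\text{ for some }c\in N\text{ with }v\in\operatorname{cl}A_c\},$$ where $\operatorname{hull}$ is the convex hull. Let $D_N(v)=\{0\}$ for $v\in I_N$, $D_N(v)=F_N(v)$ for $v\in A_N$, and $D_N(v)=\operatorname{hull}(\{0\}\cup F_N(v))$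 otherwise. A solution of $\dot v\in D_N(v)$ on $[a,b]$ is an absolutely continuous $v$ with $\dot v(s)\in D_N(v(s))$ for almost every $s\in[a,b]$. Call $N$ nondegenerate if $0\notin F_N(v)$ for every $v\in A_N$. Call $N$ dissipative if there is a function $\beta:[0,\infty)\to[0,1)$ with $\beta(s)>0$ for $s>0$ such that for every $s>0$ and every solution $v$ of $\dot v\in D_N(v)$ on $[0,s]$ with $v([0,s])\subseteq A_N$ and $\|v(0)\|_2=1$, one has $\|v(s)\|_2\le 1-\beta(s)$. Theorem. (1) $N$ is nondegenerate if and only if it is dissipative. (2) If $N$ is nondegenerate, there is a constant $S>0$, depending only on $N$, such that for every solution $v$ of $\dot v\in D_N(v)$ on $[0,S\|v(0)\|_2]$ there is $s^*\in[0,S\|v(0)\|_2]$ with $v(s^*)\notin A_N$; that is, the impact terminates within simulation time $S\|v(0)\|_2$. -/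

import Mathlib

open MeasureTheory Set

/-- Generalized velocities with the Euclidean norm (in the coordinates in which the kinetic
energy is `‖v‖ ^ 2 / 2`). -/
abbrev Velocity (n : ℕ) : Type := EuclideanSpace ℝ (Fin n)

/-- A contact: the row `J_n` of the normal Jacobian (as a vector, acting by the inner product),
the two rows `J_t` of the tangential Jacobian (as a linear map to the plane), and the friction
coefficient. The contact is frictional if `mu > 0` and frictionless if `mu = 0`; in the latter
case `tangent` plays no role. -/
structure Contact (n : ℕ) where
  normal : Velocity n
  tangent : Velocity n →L[ℝ] EuclideanSpace ℝ (Fin 2)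
  mu : ℝ
  mu_nonneg : 0 ≤ mu

/-- A set of `m` contacts on a system with `n` degrees of freedom. -/
abbrev ContactSet (n m : ℕ) : Type := Fin m → Contact n

/-- The set-valued unit direction: `{u / ‖u‖}` for `u ≠ 0`, the closed unit ball for `u = 0`. -/
def unitDir (u : EuclideanSpace ℝ (Fin 2)) : Set (EuclideanSpace ℝ (Fin 2)) :=
  {w | (u ≠ 0 ∧ w = ‖u‖⁻¹ • u) ∨ (u = 0 ∧ ‖w‖ ≤ 1)}

namespace Contact

/-- The velocities that actively penetrate the contact: `J_n v < 0`. -/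
def penetrating {n : ℕ} (c : Contact n) : Set (Velocity n) :=
  {v | inner ℝ c.normal v < 0}

/-- The net forces of one contact under a unit normal force:
`J_nᵀ - μ J_tᵀ Unit (J_t v)`. -/
noncomputable def netForce {n : ℕ} (c : Contact n) (v : Velocity n) : Set (Velocity n) :=
  (fun w => c.normal - c.mu • (ContinuousLinearMap.adjoint c.tangent) w) '' unitDir (c.tangent v)

end Contact

namespace ContactSet

/-- The actively penetrating velocities: `J_n v < 0` for some contact. -/
def penetrating {n m : ℕ} (C : ContactSet n m) : Set (Velocity n) :=
  {v | ∃ i, inner ℝ (C i).normal v < 0}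

/-- The separating velocities: the interior of the complement of the penetrating ones. -/
def separating {n m : ℕ} (C : ContactSet n m) : Set (Velocity n) :=
  interior (C.penetratingᶜ)

/-- The permissible net forces: convex combinations of the net forces of the individual contacts
that are not separating at `v`. -/
noncomputable def netForce {n m : ℕ} (C : ContactSet n m) (v : Velocity n) : Set (Velocity n) :=
  convexHull ℝ {f | ∃ i, v ∈ closure (C i).penetrating ∧ f ∈ (C i).netForce v}

open Classical in
/-- The right-hand side of the multi-contact differential inclusion. -/
noncomputable def derivMap {n m : ℕ} (C : ContactSet n m) (v : Velocity n) : Set (Velocity n) :=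
  if v ∈ C.separating then {0}
  else if v ∈ C.penetrating then C.netForce v
  else convexHull ℝ ({0} ∪ C.netForce v)

end ContactSet

/-- `v` solves the differential inclusion `v' ∈ D v` on `[a, b]`: it is absolutely continuous
there and its derivative lies in `D (v s)` for almost every `s` in `[a, b]`. -/
def IsSolution {n : ℕ} (D : Velocity n → Set (Velocity n)) (a b : ℝ) (v : ℝ → Velocity n) : Prop :=
  AbsolutelyContinuousOnInterval v a b ∧
    ∀ᵐ s ∂(volume.restrict (Icc a b)), ∃ d ∈ D (v s), HasDerivAt v d s

namespace ContactSet

/-- Zero is not a permissible net force at any actively penetrating velocity. -/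
def Nondegenerate {n m : ℕ} (C : ContactSet n m) : Prop :=
  ∀ v ∈ C.penetrating, (0 : Velocity n) ∉ C.netForce v

/-- `β`-dissipativity, for `β` positive definite from `[0, ∞)` to `[0, 1)`. -/
def DissipativeWith {n m : ℕ} (C : ContactSet n m) (β : ℝ → ℝ) : Prop :=
  (∀ s, 0 ≤ s → β s ∈ Ico (0 : ℝ) 1) ∧ (∀ s, 0 < s → 0 < β s) ∧
    ∀ s, 0 < s → ∀ v : ℝ → Velocity n, IsSolution C.derivMap 0 s v →
      (∀ r ∈ Icc 0 s, v r ∈ C.penetrating) → ‖v 0‖ = 1 → ‖v s‖ ≤ 1 - β s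

/-- The contact set is `β`-dissipative for some positive definite `β`. -/
def Dissipative {n m : ℕ} (C : ContactSet n m) : Prop :=
  ∃ β : ℝ → ℝ, C.DissipativeWith β

end ContactSet

open Filter Topology
open scoped NNReal InnerProductSpace

/-! ### Absolutely continuous functions -/

/-! If `0` is a net force at a penetrating velocity, resting at the normalized velocity is a
solution that loses no energy, so dissipativity implies nondegeneracy.

Conversely, an active contact dissipates energy at the rate of its normal force times its `slip`, so
energy stalls only near velocities neutral for the contacts doing the work. The argument runs over
relaxed solutions, driven by a subset `C` of the contacts up to an error measured by `R`. Contacts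
with slip bounded below can then be dropped, the energy they dissipate paying for the error
(`IsRelaxedSolution.restrict`).

If contraction were not uniform, Arzelà–Ascoli would give a limit `w` of constant norm 1. Almost
everywhere its derivative is neutral for the contacts neutral at that time, yet orthogonal to their
neutral space, as their forces are. So `w` is constant (`IsNeutralLimit.eq_initial`). The contacts
neutral at `w 0` can balance each other, for otherwise they would push `w` away. Nondegeneracy,
applied to `u` and `-u` in their neutral space, makes every normal velocity vanish at `w 0`.
Subtracting `w 0` leaves penetrating motions driven by these contacts alone, starting ever closer to
0 but of fixed duration. This contradicts termination in linear time for the smaller set of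
contacts, known by induction (`terminatesInLinearTime`). Contraction gives linear time because the
inclusion is homogeneous of degree 0 (`le_of_norm_contraction`). -/

theorem LipschitzWith.comp_absolutelyContinuousOnInterval {X Y : Type*} [PseudoMetricSpace X]
    [PseudoMetricSpace Y] {φ : X → Y} {K : ℝ≥0} (hφ : LipschitzWith K φ) {f : ℝ → X} {s t : ℝ}
    (hf : AbsolutelyContinuousOnInterval f s t) :
    AbsolutelyContinuousOnInterval (fun x => φ (f x)) s t := by
  have h := Tendsto.const_mul (K : ℝ) hf
  rw [mul_zero] at h
  refine squeeze_zero (fun E => Finset.sum_nonneg fun i _ => dist_nonneg) (fun E => ?_) h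
  rw [Finset.mul_sum]
  exact Finset.sum_le_sum fun i _ => hφ.dist_le_mul _ _

theorem AbsolutelyContinuousOnInterval.le_of_ae_hasDerivAt_nonpos {φ : ℝ → ℝ} {s t : ℝ}
    (hst : s ≤ t) (hφ : AbsolutelyContinuousOnInterval φ s t)
    (hd : ∀ᵐ x, x ∈ Icc s t → ∃ p, HasDerivAt φ p x ∧ p ≤ 0) : φ t ≤ φ s := by
  rw [← sub_nonpos, ← hφ.integral_deriv_eq_sub, intervalIntegral.integral_of_le hst]
  refine setIntegral_nonpos_ae measurableSet_Ioc ?_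
  filter_upwards [hd] with x hx hxs
  obtain ⟨p, hp, hp0⟩ := hx (Ioc_subset_Icc_self hxs)
  rwa [hp.deriv]

theorem LipschitzOnWith.absolutelyContinuousOnInterval_Icc {X : Type*} [PseudoMetricSpace X] {f : ℝ → X}
    {K : ℝ≥0} {s t : ℝ} (hst : s ≤ t) (hf : LipschitzOnWith K f (Icc s t)) :
    AbsolutelyContinuousOnInterval f s t :=
  LipschitzOnWith.absolutelyContinuousOnInterval (K := K) (by rwa [uIcc_of_le hst])

/-- Testing `v` against its own increment `ξ` reduces the bound to a scalar monotonicity statement.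
-/
theorem AbsolutelyContinuousOnInterval.lipschitzOnWith_of_ae_deriv_le {E : Type*}
    [NormedAddCommGroup E] [InnerProductSpace ℝ E] {v : ℝ → E} {s t : ℝ} {M : ℝ≥0}
    (hv : AbsolutelyContinuousOnInterval v s t)
    (hd : ∀ᵐ x, x ∈ Icc s t → ∃ d, HasDerivAt v d x ∧ ‖d‖ ≤ M) :
    LipschitzOnWith M v (Icc s t) := by
  have key : ∀ x ∈ Icc s t, ∀ y ∈ Icc s t, x ≤ y → ‖v y - v x‖ ≤ M * (y - x) := by
    intro x hx y hy hxy
    set ξ := v y - v x with hξ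
    have hsub : Icc x y ⊆ Icc s t := Icc_subset_Icc hx.1 hy.2
    have hac : AbsolutelyContinuousOnInterval v x y := by
      refine hv.mono ?_
      rwa [uIcc_of_le hxy, uIcc_of_le (hx.1.trans hx.2)]
    have h1 : AbsolutelyContinuousOnInterval (fun z => innerSL ℝ ξ (v z)) x y :=
      (innerSL ℝ ξ).lipschitz.comp_absolutelyContinuousOnInterval hac
    have h2 : AbsolutelyContinuousOnInterval (fun z => (M * ‖ξ‖) * z) x y :=
      (LipschitzWith.id.lipschitzOnWith.absolutelyContinuousOnInterval (f := id)).const_mul _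
    have h3 := (h1.sub h2).le_of_ae_hasDerivAt_nonpos hxy (by
      filter_upwards [hd] with z hz hzs
      obtain ⟨d, hd, hdM⟩ := hz (hsub hzs)
      refine ⟨_, ((innerSL ℝ ξ).hasFDerivAt.comp_hasDerivAt z hd).sub
        ((hasDerivAt_id z).const_mul (M * ‖ξ‖)), ?_⟩
      have := real_inner_le_norm ξ d
      have := mul_le_mul_of_nonneg_left hdM (norm_nonneg ξ)
      simp only [innerSL_apply_apply]
      linarith)
    simp only [Pi.sub_apply, innerSL_apply_apply] at h3
    have h4 : ⟪ξ, v y⟫_ℝ - ⟪ξ, v x⟫_ℝ = ‖ξ‖ ^ 2 := by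
      rw [← inner_sub_right, ← hξ, real_inner_self_eq_norm_sq]
    rcases (norm_nonneg ξ).eq_or_lt with h0 | h0
    · rw [← h0]; exact mul_nonneg M.2 (sub_nonneg.2 hxy)
    · nlinarith
  refine LipschitzOnWith.of_dist_le_mul fun x hx y hy => ?_
  rcases le_total x y with h | h
  · rw [dist_comm, dist_eq_norm, dist_comm, Real.dist_eq, abs_of_nonneg (sub_nonneg.2 h)]
    exact key x hx y hy h
  · rw [dist_eq_norm, Real.dist_eq, abs_of_nonneg (sub_nonneg.2 h)]
    exact key y hy x hx h

/-- A zero with nonzero derivative is isolated from the right in the zero set, and there are only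
countably many such points. -/
theorem ae_deriv_eq_zero_of_eq_zero {F : Type*} [NormedAddCommGroup F] [NormedSpace ℝ F]
    (f : ℝ → F) : ∀ᵐ x, ∀ d, f x = 0 → HasDerivAt f d x → d = 0 := by
  have hc := countable_setOfPred_isolated_right_within (s := {x | f x = 0})
  filter_upwards [hc.ae_notMem volume] with x hx d hfx hd
  by_contra hd0
  apply hx
  refine ⟨hfx, ?_⟩
  have h := (hd.eventually_ne (c := 0) hd0).filter_mono (nhdsWithin_mono x
    (inter_subset_right.trans fun y hy => ne_of_gt hy : {x | f x = 0} ∩ Ioi x ⊆ {x}ᶜ))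
  have h' : ∀ᶠ z in 𝓝[{x | f x = 0} ∩ Ioi x] x, f z = 0 :=
    eventually_mem_nhdsWithin.mono fun z hz => hz.1
  exact Filter.eventually_false_iff_eq_bot.1 (h.and h' |>.mono fun z hz => hz.1 hz.2)

/-- Uniformly Lipschitz sequences of bounded functions on a compact interval have uniformly
convergent subsequences. -/
theorem exists_subseq_tendstoUniformlyOn_of_lipschitz {E : Type*} [NormedAddCommGroup E]
    [ProperSpace E] {τ : ℝ} (hτ : 0 ≤ τ) {M : ℝ≥0} {B : ℝ} (v : ℕ → ℝ → E)
    (hv : ∀ k, LipschitzOnWith M (v k) (Icc 0 τ)) (hB : ∀ k, ∀ x ∈ Icc 0 τ, ‖v k x‖ ≤ B) :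
    ∃ (φ : ℕ → ℕ) (w : ℝ → E), StrictMono φ ∧ LipschitzWith M w ∧
      TendstoUniformlyOn (fun k => v (φ k)) w atTop (Icc 0 τ) := by
  let A : Set (BoundedContinuousFunction (Icc 0 τ) E) :=
    {f | LipschitzWith M f ∧ ∀ x, f x ∈ Metric.closedBall (0 : E) B}
  have hA : IsCompact A := by
    refine BoundedContinuousFunction.arzela_ascoli₂ (Metric.closedBall 0 B)
      (isCompact_closedBall _ _) A ?_ (fun f x hf => hf.2 x) ?_
    · have hev : ∀ x, Continuous fun f : BoundedContinuousFunction (Icc 0 τ) E => f x :=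
        fun x => by fun_prop
      refine IsClosed.and ?_ ?_
      · simp only [lipschitzWith_iff_dist_le_mul, ofPred_forall]
        exact isClosed_iInter fun x => isClosed_iInter fun y =>
          isClosed_le ((hev x).dist (hev y)) continuous_const
      · simp only [ofPred_forall]
        exact isClosed_iInter fun x => Metric.isClosed_closedBall.preimage (hev x)
    · exact (LipschitzWith.uniformEquicontinuous _ M fun f => f.2.1).equicontinuous
  let F : ℕ → BoundedContinuousFunction (Icc 0 τ) E := fun k =>
    BoundedContinuousFunction.mkOfCompact
      ⟨(Icc 0 τ).domRestrict (v k), (hv k).continuousOn.domRestrict⟩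
  have hF : ∀ k, F k ∈ A := fun k =>
    ⟨(lipschitzOnWith_iff_restrict.1 (hv k)), fun x => mem_closedBall_zero_iff.2 (hB k x x.2)⟩
  obtain ⟨f, hfA, φ, hφ, hlim⟩ := hA.tendsto_subseq hF
  -- The constant extension makes the limit Lipschitz on all of `ℝ`, so it is differentiable almost
  -- everywhere and continuous at the endpoints.
  refine ⟨φ, IccExtend hτ f, hφ, ?_, ?_⟩
  · have h := hfA.1.comp (LipschitzWith.projIcc hτ)
    rwa [mul_one] at h
  · rw [BoundedContinuousFunction.tendsto_iff_tendstoUniformly] at hlim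
    rw [Metric.tendstoUniformlyOn_iff]
    rw [Metric.tendstoUniformly_iff] at hlim
    intro ε hε
    filter_upwards [hlim ε hε] with k hk x hx
    rw [IccExtend_of_mem hτ f hx]
    exact hk ⟨x, hx⟩

/-! ### Contact forces -/

namespace Contact

variable {n : ℕ}

/-- The tangential Jacobian weighted by the friction coefficient. -/
noncomputable def frictionMap (c : Contact n) : Velocity n →L[ℝ] EuclideanSpace ℝ (Fin 2) :=
  c.mu • c.tangent

/-- The generalized force with normal component `l` and (scaled) friction `-y`. -/
noncomputable def force (c : Contact n) (l : ℝ) (y : EuclideanSpace ℝ (Fin 2)) : Velocity n :=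
  l • c.normal - (ContinuousLinearMap.adjoint c.frictionMap) y

/-- Coulomb's law of friction at velocity `v`, where only contacts that are not separating may be
active. -/
def Admissible (c : Contact n) (v : Velocity n) (l : ℝ) (y : EuclideanSpace ℝ (Fin 2)) : Prop :=
  0 ≤ l ∧ ‖y‖ ≤ l ∧ ⟪y, c.frictionMap v⟫_ℝ = l * ‖c.frictionMap v‖ ∧ (l ≠ 0 → ⟪c.normal, v⟫_ℝ ≤ 0)

/-- The velocities at which a contact has neither normal nor frictional tangential velocity. -/
noncomputable def neutral (c : Contact n) : Submodule ℝ (Velocity n) :=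
  LinearMap.ker (innerSL ℝ c.normal).toLinearMap ⊓ LinearMap.ker c.frictionMap.toLinearMap

theorem mem_neutral {c : Contact n} {v : Velocity n} :
    v ∈ c.neutral ↔ ⟪c.normal, v⟫_ℝ = 0 ∧ c.frictionMap v = 0 := by
  simp [neutral]

/-- The rate at which a unit force of an active contact dissipates energy. -/
noncomputable def slip (c : Contact n) (v : Velocity n) : ℝ :=
  |⟪c.normal, v⟫_ℝ| + ‖c.frictionMap v‖

theorem continuous_slip (c : Contact n) : Continuous c.slip := by
  unfold slip; fun_prop

theorem slip_nonneg (c : Contact n) (v : Velocity n) : 0 ≤ c.slip v := by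
  unfold slip; positivity

theorem slip_eq_zero_iff {c : Contact n} {v : Velocity n} : c.slip v = 0 ↔ v ∈ c.neutral := by
  rw [mem_neutral, slip, add_eq_zero_iff_of_nonneg (abs_nonneg _) (norm_nonneg _), abs_eq_zero,
    norm_eq_zero]

theorem inner_force (c : Contact n) (v : Velocity n) (l : ℝ) (y : EuclideanSpace ℝ (Fin 2)) :
    ⟪v, c.force l y⟫_ℝ = l * ⟪c.normal, v⟫_ℝ - ⟪y, c.frictionMap v⟫_ℝ := by
  rw [force, inner_sub_right, inner_smul_right, ContinuousLinearMap.adjoint_inner_right,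
    real_inner_comm, real_inner_comm y]

/-- Friction is opposed to the sliding velocity, and the normal velocity of an active contact is
nonpositive, so both terms dissipate. -/
theorem Admissible.inner_force_eq {c : Contact n} {v : Velocity n} {l : ℝ}
    {y : EuclideanSpace ℝ (Fin 2)} (h : c.Admissible v l y) :
    ⟪v, c.force l y⟫_ℝ = -(l * c.slip v) := by
  obtain ⟨_, -, h2, h3⟩ := h
  rw [inner_force, h2, slip]
  rcases eq_or_ne l 0 with h0 | h0
  · simp [h0]
  · rw [abs_of_nonpos (h3 h0)]; ring

theorem norm_force_le {c : Contact n} {M l : ℝ} (hM : ‖c.normal‖ + ‖c.frictionMap‖ ≤ M)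
    {y : EuclideanSpace ℝ (Fin 2)} (hy : ‖y‖ ≤ l) : ‖c.force l y‖ ≤ M * l := by
  have hl : 0 ≤ l := (norm_nonneg y).trans hy
  have h1 : ‖(ContinuousLinearMap.adjoint c.frictionMap) y‖ ≤ ‖c.frictionMap‖ * l := by
    refine (ContinuousLinearMap.le_opNorm _ _).trans ?_
    rw [LinearIsometryEquiv.norm_map]
    gcongr
  calc ‖c.force l y‖ ≤ ‖l • c.normal‖ + ‖(ContinuousLinearMap.adjoint c.frictionMap) y‖ :=
        norm_sub_le _ _
    _ ≤ l * ‖c.normal‖ + ‖c.frictionMap‖ * l := by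
        rw [norm_smul, Real.norm_of_nonneg hl]; gcongr
    _ = (‖c.normal‖ + ‖c.frictionMap‖) * l := by ring
    _ ≤ M * l := by gcongr

theorem inner_force_of_mem_neutral {c : Contact n} {ξ : Velocity n} (hξ : ξ ∈ c.neutral)
    (l : ℝ) (y : EuclideanSpace ℝ (Fin 2)) : ⟪ξ, c.force l y⟫_ℝ = 0 := by
  rw [mem_neutral] at hξ
  simp [inner_force, hξ.1, hξ.2]

/-- Coulomb's law sees a velocity only through its normal and frictional components. This permits
subtracting neutral velocities from solutions. -/
theorem Admissible.add {c : Contact n} {v : Velocity n} {l : ℝ}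
    {y : EuclideanSpace ℝ (Fin 2)} (h : c.Admissible v l y) {u : Velocity n}
    (hu : u ∈ c.neutral) : c.Admissible (v + u) l y := by
  rw [mem_neutral] at hu
  simpa [Admissible, inner_add_right, hu.1, hu.2] using h

theorem Admissible.smul {c : Contact n} {v : Velocity n} {l : ℝ}
    {y : EuclideanSpace ℝ (Fin 2)} (h : c.Admissible v l y) {σ : ℝ} (hσ : 0 ≤ σ) :
    c.Admissible (σ • v) l y := by
  obtain ⟨h0, h1, h2, h3⟩ := h
  refine ⟨h0, h1, ?_, fun hl => ?_⟩
  · rw [map_smul, inner_smul_right, h2, norm_smul, Real.norm_of_nonneg hσ]; ring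
  · rw [inner_smul_right]; exact mul_nonpos_of_nonneg_of_nonpos hσ (h3 hl)

end Contact

/-! ### Neutral spaces and balancing sets of contacts -/

namespace ContactSet

variable {n m : ℕ} (N : ContactSet n m)

/-- The velocities at which all contacts in `C` are neutral. -/
noncomputable def neutral (C : Finset (Fin m)) : Submodule ℝ (Velocity n) :=
  ⨅ c ∈ C, (N c).neutral

/-- The total force of the contacts in `C`. -/
noncomputable def force (C : Finset (Fin m)) (l : Fin m → ℝ)
    (y : Fin m → EuclideanSpace ℝ (Fin 2)) : Velocity n :=
  ∑ c ∈ C, (N c).force (l c) (y c)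

/-- The contacts in `C` can balance each other when all of them stick. -/
def Degenerate (C : Finset (Fin m)) : Prop :=
  ∃ (l : Fin m → ℝ) (y : Fin m → EuclideanSpace ℝ (Fin 2)),
    (∀ c ∈ C, 0 ≤ l c ∧ ‖y c‖ ≤ l c) ∧ ∑ c ∈ C, l c = 1 ∧ N.force C l y = 0

variable {N}

theorem mem_neutral {C : Finset (Fin m)} {v : Velocity n} :
    v ∈ N.neutral C ↔ ∀ c ∈ C, v ∈ (N c).neutral := by
  simp [neutral]

theorem inner_force_of_mem_neutral {C : Finset (Fin m)} {ξ : Velocity n} (hξ : ξ ∈ N.neutral C)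
    (l : Fin m → ℝ) (y : Fin m → EuclideanSpace ℝ (Fin 2)) : ⟪ξ, N.force C l y⟫_ℝ = 0 := by
  rw [force, inner_sum]
  exact Finset.sum_eq_zero fun c hc =>
    Contact.inner_force_of_mem_neutral (mem_neutral.1 hξ c hc) _ _

/-- If the contacts in `C` cannot balance each other, some direction is pushed by all of them. -/
theorem exists_inner_force_ge_of_not_degenerate {C : Finset (Fin m)} (hC : ¬ N.Degenerate C) :
    ∃ (ξ : Velocity n) (α : ℝ), 0 < α ∧ ∀ (l : Fin m → ℝ) (y : Fin m → EuclideanSpace ℝ (Fin 2)),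
      (∀ c ∈ C, 0 ≤ l c ∧ ‖y c‖ ≤ l c) → α * ∑ c ∈ C, l c ≤ ⟪ξ, N.force C l y⟫_ℝ := by
  -- Weights outside `C` are set to zero to make `S` compact; then `0` is strictly separated from
  -- its convex compact image.
  let S : Set ((Fin m → ℝ) × (Fin m → EuclideanSpace ℝ (Fin 2))) :=
    {p | (∀ c, 0 ≤ p.1 c ∧ ‖p.2 c‖ ≤ p.1 c) ∧ (∀ c ∉ C, p.1 c = 0) ∧ ∑ c ∈ C, p.1 c = 1}
  let Φ : (Fin m → ℝ) × (Fin m → EuclideanSpace ℝ (Fin 2)) →L[ℝ] Velocity n :=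
    ∑ c ∈ C, (((ContinuousLinearMap.proj (R := ℝ) (φ := fun _ : Fin m => ℝ) c).comp
      (ContinuousLinearMap.fst ℝ _ _)).smulRight (N c).normal -
      (ContinuousLinearMap.adjoint (N c).frictionMap).comp
        ((ContinuousLinearMap.proj (R := ℝ) (φ := fun _ : Fin m => EuclideanSpace ℝ (Fin 2)) c).comp
          (ContinuousLinearMap.snd ℝ _ _)))
  have hΦ : ∀ p, Φ p = N.force C p.1 p.2 := by
    intro p
    simp [Φ, force, Contact.force]
  have hconv : Convex ℝ S := by
    rintro p ⟨hp1, hp2, hp3⟩ q ⟨hq1, hq2, hq3⟩ s t hs ht hst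
    refine ⟨fun c => ⟨?_, ?_⟩, fun c hc => ?_, ?_⟩
    · have := mul_nonneg hs (hp1 c).1
      have := mul_nonneg ht (hq1 c).1
      simpa using by linarith
    · refine (norm_add_le _ _).trans ?_
      simp only [Prod.smul_snd, Pi.smul_apply, norm_smul, Real.norm_of_nonneg hs,
        Real.norm_of_nonneg ht, Prod.fst_add, Prod.smul_fst, Pi.add_apply, smul_eq_mul]
      exact add_le_add (mul_le_mul_of_nonneg_left (hp1 c).2 hs)
        (mul_le_mul_of_nonneg_left (hq1 c).2 ht)
    · simp [hp2 c hc, hq2 c hc]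
    · simp [Finset.sum_add_distrib, ← Finset.mul_sum, hp3, hq3, hst]
  have hclosed : IsClosed S := by
    refine IsClosed.and ?_ (IsClosed.and ?_ ?_)
    · simp only [ofPred_forall]
      exact isClosed_iInter fun c => (isClosed_le (by fun_prop) (by fun_prop)).and
        (isClosed_le (by fun_prop) (by fun_prop))
    · simp only [ofPred_forall]
      exact isClosed_iInter fun c => isClosed_iInter fun _ => isClosed_eq (by fun_prop) (by fun_prop)
    · exact isClosed_eq (by fun_prop) (by fun_prop)
  have hcompact : IsCompact S := by
    refine (isCompact_closedBall (0 : (Fin m → ℝ) × (Fin m → EuclideanSpace ℝ (Fin 2))) 1)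
      |>.of_isClosed_subset hclosed ?_
    rintro p ⟨hp1, hp2, hp3⟩
    have hle : ∀ c, p.1 c ≤ 1 := by
      intro c
      by_cases hc : c ∈ C
      · rw [← hp3]; exact Finset.single_le_sum (fun i _ => (hp1 i).1) hc
      · rw [hp2 c hc]; exact zero_le_one
    rw [mem_closedBall_zero_iff, Prod.norm_def, max_le_iff, pi_norm_le_iff_of_nonneg zero_le_one,
      pi_norm_le_iff_of_nonneg zero_le_one]
    exact ⟨fun c => by rw [Real.norm_of_nonneg (hp1 c).1]; exact hle c,
      fun c => (hp1 c).2.trans (hle c)⟩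
  have h0 : (0 : Velocity n) ∉ Φ '' S := by
    rintro ⟨p, ⟨hp1, hp2, hp3⟩, hp0⟩
    exact hC ⟨p.1, p.2, fun c _ => hp1 c, hp3, by rw [← hΦ, hp0]⟩
  obtain ⟨f, α, hα, hf⟩ := geometric_hahn_banach_point_closed
    (hconv.linear_image Φ.toLinearMap) (hcompact.image Φ.continuous).isClosed h0
  rw [map_zero] at hα
  refine ⟨(InnerProductSpace.toDual ℝ (Velocity n)).symm f, α, hα, fun l y hly => ?_⟩
  rw [InnerProductSpace.toDual_symm_apply]
  have hsum0 : 0 ≤ ∑ c ∈ C, l c := Finset.sum_nonneg fun c hc => (hly c hc).1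
  rcases hsum0.eq_or_lt with h | h
  · have hl : ∀ c ∈ C, l c = 0 := (Finset.sum_eq_zero_iff_of_nonneg fun c hc => (hly c hc).1).1 h.symm
    have : N.force C l y = 0 := Finset.sum_eq_zero fun c hc => by
      have hy : y c = 0 := norm_le_zero_iff.1 ((hly c hc).2.trans_eq (hl c hc))
      simp [Contact.force, hl c hc, hy]
    simp [this, ← h]
  · set s := ∑ c ∈ C, l c with hs
    have hmem : Φ (fun c => if c ∈ C then s⁻¹ * l c else 0,
        fun c => if c ∈ C then s⁻¹ • y c else 0) ∈ Φ '' S := by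
      refine mem_image_of_mem _ ⟨fun c => ?_, fun c hc => by simp [hc], ?_⟩
      · by_cases hc : c ∈ C
        · simp only [hc, if_true, norm_smul, norm_inv, Real.norm_of_nonneg h.le]
          exact ⟨mul_nonneg (by positivity) (hly c hc).1,
            mul_le_mul_of_nonneg_left (hly c hc).2 (by positivity)⟩
        · simp [hc]
      · rw [Finset.sum_congr rfl fun c hc => if_pos hc, ← Finset.mul_sum, ← hs,
          inv_mul_cancel₀ h.ne']
    have h1 := hf _ hmem
    have h2 : Φ (fun c => if c ∈ C then s⁻¹ * l c else 0,
        fun c => if c ∈ C then s⁻¹ • y c else 0) = s⁻¹ • N.force C l y := by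
      rw [hΦ, force, force, Finset.smul_sum]
      refine Finset.sum_congr rfl fun c hc => ?_
      simp only [hc, if_true, Contact.force, map_smul, smul_sub, smul_smul]
    rw [h2, map_smul, smul_eq_mul, lt_inv_mul_iff₀ h] at h1
    rw [mul_comm]; exact h1.le

end ContactSet

/-! ### Relaxed solutions -/

theorem AbsolutelyContinuousOnInterval.comp_affine {X : Type*} [PseudoMetricSpace X] {f : ℝ → X}
    {s σ a b : ℝ} (hσ : 0 < σ) (hf : AbsolutelyContinuousOnInterval f (s + σ * a) (s + σ * b)) :
    AbsolutelyContinuousOnInterval (fun x => f (s + σ * x)) a b := by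
  rw [absolutelyContinuousOnInterval_iff] at hf ⊢
  intro ε hε
  obtain ⟨δ, hδ, h⟩ := hf ε hε
  refine ⟨δ / σ, by positivity, fun E hE hlen => ?_⟩
  refine h (E.1, fun i => (s + σ * (E.2 i).1, s + σ * (E.2 i).2)) ⟨fun i hi => ?_, ?_⟩ ?_
  · have hmem : ∀ z ∈ uIcc a b, s + σ * z ∈ uIcc (s + σ * a) (s + σ * b) := by
      intro z hz
      rw [mem_uIcc] at hz ⊢
      rcases hz with ⟨h1, h2⟩ | ⟨h1, h2⟩
      · left; constructor <;> gcongr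
      · right; constructor <;> gcongr
    exact ⟨hmem _ (hE.1 i hi).1, hmem _ (hE.1 i hi).2⟩
  · intro i hi j hj hij
    have hd := hE.2 hi hj hij
    simp only [Function.onFun, Set.disjoint_left] at hd ⊢
    have hmem : ∀ x y z : ℝ, z ∈ uIoc (s + σ * x) (s + σ * y) → (z - s) / σ ∈ uIoc x y := by
      intro x y z hz
      simp only [mem_uIoc, lt_div_iff₀ hσ, div_le_iff₀ hσ] at hz ⊢
      rcases hz with ⟨h1, h2⟩ | ⟨h1, h2⟩
      · left; constructor <;> linarith
      · right; constructor <;> linarith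
    exact fun z hz hz' => hd (hmem _ _ _ hz) (hmem _ _ _ hz')
  · have : ∀ i, dist (s + σ * (E.2 i).1) (s + σ * (E.2 i).2)
        = σ * dist (E.2 i).1 (E.2 i).2 := by
      intro i
      rw [Real.dist_eq, Real.dist_eq, add_sub_add_left_eq_sub, ← mul_sub, abs_mul, abs_of_pos hσ]
    simp only [this, ← Finset.mul_sum]
    rwa [lt_div_iff₀' hσ] at hlen

theorem ae_comp_affine {p : ℝ → Prop} (hp : ∀ᵐ x, p x) (s : ℝ) {σ : ℝ} (hσ : σ ≠ 0) :
    ∀ᵐ x : ℝ, p (s + σ * x) := by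
  have h1 : Measure.QuasiMeasurePreserving (fun x : ℝ => σ * x) volume volume :=
    ⟨measurable_const_mul σ, by
      rw [Real.map_volume_mul_left hσ]; exact Measure.smul_absolutelyContinuous⟩
  have h2 := (measurePreserving_add_left (volume : Measure ℝ) s).quasiMeasurePreserving.comp h1
  exact h2.ae hp

namespace ContactSet

variable {n m : ℕ} (N : ContactSet n m)

/-- `d` is a net force of the contacts in `C` at velocity `v`, up to an error of weight `r`. -/
def IsRelaxedForce (M : ℝ≥0) (C : Finset (Fin m)) (v d : Velocity n) (r : ℝ) : Prop :=
  0 ≤ r ∧ ∃ (l : Fin m → ℝ) (y : Fin m → EuclideanSpace ℝ (Fin 2)),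
    (∀ c ∈ C, (N c).Admissible v (l c) (y c)) ∧ 1 - r ≤ ∑ c ∈ C, l c ∧
      ‖d - N.force C l y‖ ≤ M * r

/-- `v` is a Lipschitz solution on `[s, t]` of the inclusion driven by the contacts in `C`, up to
errors whose total weight is the increase of `R`. -/
structure IsRelaxedSolution (M : ℝ≥0) (C : Finset (Fin m)) (v : ℝ → Velocity n) (R : ℝ → ℝ)
    (s t : ℝ) : Prop where
  le : s ≤ t
  lipschitz : LipschitzOnWith M v (Icc s t)
  ac : AbsolutelyContinuousOnInterval R s t
  deriv : ∀ᵐ x, x ∈ Icc s t → ∃ d r, HasDerivAt v d x ∧ HasDerivAt R r x ∧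
    N.IsRelaxedForce M C (v x) d r

/-- An upper bound for the forces under unit normal forces. -/
def ForceBound (M : ℝ≥0) : Prop := ∀ c, ‖(N c).normal‖ + ‖(N c).frictionMap‖ ≤ M

variable {N} {M : ℝ≥0} {C : Finset (Fin m)} {v : ℝ → Velocity n} {R : ℝ → ℝ} {s t : ℝ}

theorem exists_forceBound (N : ContactSet n m) : ∃ M : ℝ≥0, N.ForceBound M := by
  refine ⟨∑ c, (‖(N c).normal‖₊ + ‖(N c).frictionMap‖₊), fun c => ?_⟩
  have := Finset.single_le_sum (f := fun c => ‖(N c).normal‖₊ + ‖(N c).frictionMap‖₊)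
    (fun i _ => zero_le) (Finset.mem_univ c)
  exact_mod_cast this

theorem IsRelaxedForce.inner_le {w d : Velocity n} {r : ℝ} (h : N.IsRelaxedForce M C w d r) :
    ⟪w, d⟫_ℝ ≤ M * ‖w‖ * r := by
  obtain ⟨hr, l, y, hly, -, herr⟩ := h
  have h1 : ⟪w, N.force C l y⟫_ℝ ≤ 0 := by
    rw [force, inner_sum]
    refine Finset.sum_nonpos fun c hc => ?_
    rw [(hly c hc).inner_force_eq, neg_nonpos]
    exact mul_nonneg (hly c hc).1 ((N c).slip_nonneg w)
  have h2 : ⟪w, d - N.force C l y⟫_ℝ ≤ ‖w‖ * (M * r) :=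
    (real_inner_le_norm _ _).trans (mul_le_mul_of_nonneg_left herr (norm_nonneg _))
  rw [inner_sub_right] at h2
  linarith

/-- Contacts whose activity dissipates energy at a definite rate can be treated as errors. -/
theorem IsRelaxedForce.restrict (hM : N.ForceBound M) {C₀ : Finset (Fin m)} (hC : C₀ ⊆ C)
    {w d : Velocity n} {r α B : ℝ} (hα : 0 < α) (hB : ‖w‖ ≤ B)
    (hslip : ∀ c ∈ C \ C₀, α ≤ (N c).slip w) (h : N.IsRelaxedForce M C w d r) :
    N.IsRelaxedForce M C₀ w d (r + α⁻¹ * (M * B * r - ⟪w, d⟫_ℝ)) := by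
  obtain ⟨hr, l, y, hly, hsum, herr⟩ := h
  have hM0 : (0 : ℝ) ≤ M := M.2
  have hl0 : ∀ c ∈ C \ C₀, 0 ≤ l c := fun c hc => (hly c (Finset.sdiff_subset hc)).1
  -- Energy balance: each dropped unit of force costs at least `α` of power, and the relaxation
  -- error supplies at most `M * B * r`.
  have hdiss : ∑ c ∈ C \ C₀, l c ≤ α⁻¹ * (M * B * r - ⟪w, d⟫_ℝ) := by
    rw [le_inv_mul_iff₀ hα]
    have h1 : ⟪w, N.force C l y⟫_ℝ ≤ -(α * ∑ c ∈ C \ C₀, l c) := by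
      rw [force, inner_sum, ← Finset.sum_sdiff hC, Finset.mul_sum, ← Finset.sum_neg_distrib]
      have h2 : ∑ c ∈ C₀, ⟪w, (N c).force (l c) (y c)⟫_ℝ ≤ 0 := Finset.sum_nonpos fun c hc => by
        rw [(hly c (hC hc)).inner_force_eq, neg_nonpos]
        exact mul_nonneg (hly c (hC hc)).1 ((N c).slip_nonneg w)
      have h3 : ∑ c ∈ C \ C₀, ⟪w, (N c).force (l c) (y c)⟫_ℝ ≤ ∑ c ∈ C \ C₀, -(α * l c) := by
        refine Finset.sum_le_sum fun c hc => ?_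
        rw [(hly c (Finset.sdiff_subset hc)).inner_force_eq, neg_le_neg_iff, mul_comm]
        exact mul_le_mul_of_nonneg_left (hslip c hc) (hl0 c hc)
      linarith
    have h2 : ⟪w, d - N.force C l y⟫_ℝ ≤ B * (M * r) :=
      (real_inner_le_norm _ _).trans (mul_le_mul hB herr (norm_nonneg _) ((norm_nonneg _).trans hB))
    rw [inner_sub_right] at h2
    linarith
  have hsum0 : 0 ≤ ∑ c ∈ C \ C₀, l c := Finset.sum_nonneg hl0
  refine ⟨by linarith, l, y, fun c hc => hly c (hC hc), ?_, ?_⟩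
  · rw [← Finset.sum_sdiff hC] at hsum
    linarith
  · have h1 : d - N.force C₀ l y = (d - N.force C l y) + N.force (C \ C₀) l y := by
      rw [force, force, force, ← Finset.sum_sdiff hC]; abel
    have h2 : ‖N.force (C \ C₀) l y‖ ≤ M * ∑ c ∈ C \ C₀, l c := by
      rw [force, Finset.mul_sum]
      exact norm_sum_le_of_le _ fun c hc =>
        Contact.norm_force_le (hM c) (hly c (Finset.sdiff_subset hc)).2.1
    rw [h1]
    refine (norm_add_le _ _).trans ?_
    rw [mul_add]
    exact add_le_add herr (h2.trans (mul_le_mul_of_nonneg_left hdiss hM0))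

theorem IsRelaxedForce.add {w u d : Velocity n} {r : ℝ} (h : N.IsRelaxedForce M C w d r)
    (hu : u ∈ N.neutral C) : N.IsRelaxedForce M C (w + u) d r := by
  obtain ⟨hr, l, y, hly, hsum, herr⟩ := h
  exact ⟨hr, l, y, fun c hc => (hly c hc).add (mem_neutral.1 hu c hc), hsum, herr⟩

theorem IsRelaxedForce.smul {w d : Velocity n} {r σ : ℝ} (h : N.IsRelaxedForce M C w d r)
    (hσ : 0 ≤ σ) : N.IsRelaxedForce M C (σ • w) d r := by
  obtain ⟨hr, l, y, hly, hsum, herr⟩ := h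
  exact ⟨hr, l, y, fun c hc => (hly c hc).smul hσ, hsum, herr⟩

theorem force_mem_neutral_orthogonal (l : Fin m → ℝ) (y : Fin m → EuclideanSpace ℝ (Fin 2)) :
    N.force C l y ∈ (N.neutral C)ᗮ :=
  (Submodule.mem_orthogonal _ _).2 fun _ hu => inner_force_of_mem_neutral hu l y

/-- The projection alters `w` by a neutral velocity, which Coulomb's law ignores, and fixes the
contact forces, so the error can only shrink. -/
theorem IsRelaxedForce.starProjection {w d : Velocity n} {r : ℝ}
    (h : N.IsRelaxedForce M C w d r) :
    N.IsRelaxedForce M C ((N.neutral C)ᗮ.starProjection w) ((N.neutral C)ᗮ.starProjection d) r := by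
  have h1 : (N.neutral C)ᗮ.starProjection w = w + -(N.neutral C).starProjection w := by
    rw [Submodule.starProjection_orthogonal', ← sub_eq_add_neg]; simp
  rw [h1]
  obtain ⟨hr, l, y, hly, hsum, herr⟩ :=
    h.add (Submodule.neg_mem _ ((N.neutral C).starProjection_apply_mem w))
  refine ⟨hr, l, y, hly, hsum, le_trans ?_ herr⟩
  rw [← Submodule.starProjection_eq_self_iff.2 (force_mem_neutral_orthogonal l y), ← map_sub]
  refine (Submodule.norm_starProjection_apply_le _ _).trans_eq ?_
  rw [Submodule.starProjection_eq_self_iff.2 (force_mem_neutral_orthogonal l y)]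

namespace IsRelaxedSolution

theorem mono (h : N.IsRelaxedSolution M C v R s t) {s' t' : ℝ} (hs : s ≤ s') (hst : s' ≤ t')
    (ht : t' ≤ t) : N.IsRelaxedSolution M C v R s' t' where
  le := hst
  lipschitz := h.lipschitz.mono (Icc_subset_Icc hs ht)
  ac := h.ac.mono (by rw [uIcc_of_le hst, uIcc_of_le h.le]; exact Icc_subset_Icc hs ht)
  deriv := h.deriv.mono fun _ hx hxs => hx (Icc_subset_Icc hs ht hxs)

theorem ac_velocity (h : N.IsRelaxedSolution M C v R s t) : AbsolutelyContinuousOnInterval v s t :=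
  LipschitzOnWith.absolutelyContinuousOnInterval_Icc h.le h.lipschitz

theorem error_le (h : N.IsRelaxedSolution M C v R s t) : R s ≤ R t := by
  have := h.ac.neg.le_of_ae_hasDerivAt_nonpos h.le (by
    filter_upwards [h.deriv] with x hx hxs
    obtain ⟨d, r, -, hr, hf⟩ := hx hxs
    exact ⟨_, hr.neg, neg_nonpos.2 hf.1⟩)
  simpa using this

theorem inner_ge (h : N.IsRelaxedSolution M C v R s t) {ξ : Velocity n} {κ γ : ℝ}
    (hf : ∀ w d r, N.IsRelaxedForce M C w d r → κ ≤ ⟪ξ, d⟫_ℝ + γ * r) :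
    κ * (t - s) ≤ ⟪ξ, v t - v s⟫_ℝ + γ * (R t - R s) := by
  have h1 : AbsolutelyContinuousOnInterval (fun z => innerSL ℝ ξ (v z)) s t :=
    (innerSL ℝ ξ).lipschitz.comp_absolutelyContinuousOnInterval h.ac_velocity
  have h2 : AbsolutelyContinuousOnInterval (fun z => κ * z) s t :=
    (LipschitzWith.id.lipschitzOnWith.absolutelyContinuousOnInterval (f := id)).const_mul _
  have := (h2.sub (h1.add (h.ac.const_mul γ))).le_of_ae_hasDerivAt_nonpos h.le (by
    filter_upwards [h.deriv] with x hx hxs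
    obtain ⟨d, r, hd, hr, hdr⟩ := hx hxs
    refine ⟨_, ((hasDerivAt_id x).const_mul κ).sub
      (((innerSL ℝ ξ).hasFDerivAt.comp_hasDerivAt x hd).add (hr.const_mul γ)), ?_⟩
    have := hf _ _ _ hdr
    simp only [innerSL_apply_apply]
    linarith)
  simp only [Pi.sub_apply, Pi.add_apply, innerSL_apply_apply] at this
  rw [inner_sub_right]
  linarith

/-- Contact forces are orthogonal to the neutral space, so only the error moves this component. -/
theorem inner_le_of_mem_neutral (h : N.IsRelaxedSolution M C v R s t) {ξ : Velocity n}
    (hξ : ξ ∈ N.neutral C) : |⟪ξ, v t - v s⟫_ℝ| ≤ M * ‖ξ‖ * (R t - R s) := by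
  have key : ∀ ξ ∈ N.neutral C, 0 ≤ ⟪ξ, v t - v s⟫_ℝ + M * ‖ξ‖ * (R t - R s) := by
    intro ξ hξ
    have := h.inner_ge (ξ := ξ) (κ := 0) (γ := M * ‖ξ‖) (fun w d r hf => by
      obtain ⟨hr, l, y, hly, hsum, herr⟩ := hf
      have h1 := neg_le_of_abs_le (abs_real_inner_le_norm ξ (d - N.force C l y))
      rw [inner_sub_right, inner_force_of_mem_neutral hξ] at h1
      have h2 := mul_le_mul_of_nonneg_left herr (norm_nonneg ξ)
      linarith)
    linarith
  have h1 := key ξ hξ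
  have h2 := key (-ξ) (Submodule.neg_mem _ hξ)
  rw [inner_neg_left, norm_neg] at h2
  rw [abs_le]
  constructor <;> linarith

/-- If the contacts in `C` cannot balance each other, then the velocity has to move. -/
theorem _root_.ContactSet.exists_inner_ge_of_not_degenerate (M : ℝ≥0) (hC : ¬ N.Degenerate C) :
    ∃ (ξ : Velocity n) (α γ : ℝ), 0 < α ∧ ∀ v R s t, N.IsRelaxedSolution M C v R s t →
      α * (t - s) ≤ ⟪ξ, v t - v s⟫_ℝ + γ * (R t - R s) := by
  obtain ⟨ξ, α, hα, h⟩ := exists_inner_force_ge_of_not_degenerate hC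
  -- In the coefficient of the error, `α` covers the missing weight in `1 - r ≤ ∑ l c`, and `M *
  -- ‖ξ‖` the defect of the force.
  refine ⟨ξ, α, α + M * ‖ξ‖, hα, fun v R s t hv => hv.inner_ge fun w d r hf => ?_⟩
  obtain ⟨hr, l, y, hly, hsum, herr⟩ := hf
  have h0 := h l y fun c hc => ⟨(hly c hc).1, (hly c hc).2.1⟩
  have h1 := neg_le_of_abs_le (abs_real_inner_le_norm ξ (d - N.force C l y))
  rw [inner_sub_right] at h1
  have h2 := mul_le_mul_of_nonneg_left herr (norm_nonneg ξ)
  have h3 := mul_le_mul_of_nonneg_left hsum hα.le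
  linarith

theorem norm_le (h : N.IsRelaxedSolution M C v R s t) (h0 : ∀ x ∈ Icc s t, v x ≠ 0) :
    ‖v t‖ ≤ ‖v s‖ + M * (R t - R s) := by
  have h1 : AbsolutelyContinuousOnInterval (fun x => ‖v x‖) s t :=
    lipschitzWith_one_norm.comp_absolutelyContinuousOnInterval h.ac_velocity
  have := (h1.sub (h.ac.const_mul (M : ℝ))).le_of_ae_hasDerivAt_nonpos h.le (by
    filter_upwards [h.deriv] with x hx hxs
    obtain ⟨d, r, hd, hr, hdr⟩ := hx hxs
    have hpos : 0 < ‖v x‖ := norm_pos_iff.2 (h0 x hxs)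
    have h2 := hd.norm_sq.sqrt (by positivity)
    simp only [Real.sqrt_sq (norm_nonneg _)] at h2
    refine ⟨_, h2.sub (hr.const_mul (M : ℝ)), ?_⟩
    rw [sub_nonpos, div_le_iff₀ (by positivity)]
    have := hdr.inner_le
    linarith)
  simp only [Pi.sub_apply] at this
  linarith

/-- The new error function adds a multiple of the lost kinetic energy, whose rate is `-⟪v, v'⟫`. If
the old error and the energy change are both small, so is the new error. -/
theorem restrict (hM : N.ForceBound M) (h : N.IsRelaxedSolution M C v R s t)
    {C₀ : Finset (Fin m)} (hC : C₀ ⊆ C) {α B : ℝ} (hα : 0 < α)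
    (hB : ∀ x ∈ Icc s t, ‖v x‖ ≤ B)
    (hslip : ∀ x ∈ Icc s t, ∀ c ∈ C \ C₀, α ≤ (N c).slip (v x)) :
    N.IsRelaxedSolution M C₀ v
      (fun x => (1 + α⁻¹ * (M * B)) * R x - (α⁻¹ / 2) * ‖v x‖ ^ 2) s t where
  le := h.le
  lipschitz := h.lipschitz
  ac := by
    have h1 : AbsolutelyContinuousOnInterval (fun x => ‖v x‖) s t :=
      lipschitzWith_one_norm.comp_absolutelyContinuousOnInterval h.ac_velocity
    have h2 := h1.mul h1
    have h3 : ((fun x => ‖v x‖) * fun x => ‖v x‖) = fun x => ‖v x‖ ^ 2 := by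
      ext x; simp [sq]
    rw [h3] at h2
    exact (h.ac.const_mul _).sub (h2.const_mul _)
  deriv := by
    filter_upwards [h.deriv] with x hx hxs
    obtain ⟨d, r, hd, hr, hdr⟩ := hx hxs
    refine ⟨d, _, hd, (hr.const_mul _).sub (hd.norm_sq.const_mul _), ?_⟩
    convert hdr.restrict hM hC hα (hB x hxs) (hslip x hxs) using 1
    ring

theorem add_const (h : N.IsRelaxedSolution M C v R s t) {u : Velocity n} (hu : u ∈ N.neutral C) :
    N.IsRelaxedSolution M C (fun x => v x + u) R s t where
  le := h.le
  lipschitz := LipschitzOnWith.of_dist_le_mul fun x hx y hy => by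
    rw [dist_add_right]; exact h.lipschitz.dist_le_mul x hx y hy
  ac := h.ac
  deriv := by
    filter_upwards [h.deriv] with x hx hxs
    obtain ⟨d, r, hd, hr, hdr⟩ := hx hxs
    exact ⟨d, r, hd.add_const u, hr, hdr.add hu⟩

theorem starProjection (h : N.IsRelaxedSolution M C v R s t) :
    N.IsRelaxedSolution M C (fun x => (N.neutral C)ᗮ.starProjection (v x)) R s t where
  le := h.le
  lipschitz := LipschitzOnWith.of_dist_le_mul fun x hx y hy => by
    rw [dist_eq_norm, ← map_sub]
    refine (Submodule.norm_starProjection_apply_le _ _).trans ?_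
    rw [← dist_eq_norm]
    exact h.lipschitz.dist_le_mul x hx y hy
  ac := h.ac
  deriv := by
    filter_upwards [h.deriv] with x hx hxs
    obtain ⟨d, r, hd, hr, hdr⟩ := hx hxs
    exact ⟨_, r, ((N.neutral C)ᗮ.starProjection).hasFDerivAt.comp_hasDerivAt x hd, hr,
      hdr.starProjection⟩

/-- Admissible forces do not change under positive scaling of the velocity, so scaling velocity and
time together preserves the inclusion. -/
theorem rescale {σ τ : ℝ} (hσ : 0 < σ) (h : N.IsRelaxedSolution M C v R s (s + σ * τ)) :
    N.IsRelaxedSolution M C (fun x => σ⁻¹ • v (s + σ * x)) (fun x => σ⁻¹ * R (s + σ * x)) 0 τ := by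
  have hτ : 0 ≤ τ := by
    have := h.le
    rw [le_add_iff_nonneg_right] at this
    exact nonneg_of_mul_nonneg_right this hσ
  have hmem : ∀ x ∈ Icc 0 τ, s + σ * x ∈ Icc s (s + σ * τ) := fun x hx =>
    ⟨le_add_of_nonneg_right (mul_nonneg hσ.le hx.1), by gcongr; exact hx.2⟩
  refine ⟨hτ, ?_, ?_, ?_⟩
  · refine LipschitzOnWith.of_dist_le_mul fun x hx y hy => ?_
    have := h.lipschitz.dist_le_mul _ (hmem x hx) _ (hmem y hy)
    rw [Real.dist_eq, add_sub_add_left_eq_sub, ← mul_sub, abs_mul, abs_of_pos hσ,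
      ← Real.dist_eq] at this
    rw [dist_smul₀, norm_inv, Real.norm_of_nonneg hσ.le, inv_mul_le_iff₀ hσ]
    linarith
  · refine (AbsolutelyContinuousOnInterval.comp_affine hσ ?_).const_mul _
    simpa using h.ac
  · filter_upwards [ae_comp_affine h.deriv s hσ.ne'] with x hx hxs
    obtain ⟨d, r, hd, hr, hdr⟩ := hx (hmem x hxs)
    have haff : HasDerivAt (fun x : ℝ => s + σ * x) σ x := by
      simpa using ((hasDerivAt_id x).const_mul σ).const_add s
    refine ⟨d, r, ?_, ?_, hdr.smul (by positivity)⟩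
    · have := (hd.scomp x haff).const_smul σ⁻¹
      rwa [smul_smul, inv_mul_cancel₀ hσ.ne', one_smul] at this
    · have := (hr.comp x haff).const_mul σ⁻¹
      rwa [mul_comm r, inv_mul_cancel_left₀ hσ.ne'] at this

end IsRelaxedSolution

end ContactSet

/-! ### Compactness -/

theorem Contact.slip_le_add {n : ℕ} {c : Contact n} {M : ℝ}
    (hM : ‖c.normal‖ + ‖c.frictionMap‖ ≤ M) (u w : Velocity n) :
    c.slip w ≤ c.slip u + M * ‖w - u‖ := by
  have h1 : |⟪c.normal, w⟫_ℝ| ≤ |⟪c.normal, u⟫_ℝ| + ‖c.normal‖ * ‖w - u‖ := by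
    have := abs_real_inner_le_norm c.normal (w - u)
    rw [inner_sub_right] at this
    linarith [abs_sub_abs_le_abs_sub ⟪c.normal, w⟫_ℝ ⟪c.normal, u⟫_ℝ]
  have h2 : ‖c.frictionMap w‖ ≤ ‖c.frictionMap u‖ + ‖c.frictionMap‖ * ‖w - u‖ := by
    have := c.frictionMap.le_opNorm (w - u)
    rw [map_sub] at this
    linarith [norm_sub_norm_le (c.frictionMap w) (c.frictionMap u)]
  have h3 := mul_le_mul_of_nonneg_right hM (norm_nonneg (w - u))
  unfold slip
  linarith

namespace ContactSet

variable {n m : ℕ} {N : ContactSet n m} {M : ℝ≥0} {C : Finset (Fin m)}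

/-- A uniformly convergent sequence of relaxed solutions on `[0, τ]` whose errors and dissipated
energies vanish in the limit. -/
structure IsNeutralLimit (N : ContactSet n m) (M : ℝ≥0) (C : Finset (Fin m)) (τ : ℝ)
    (V : ℕ → ℝ → Velocity n) (Q : ℕ → ℝ → ℝ) (w : ℝ → Velocity n) : Prop where
  solution : ∀ k, N.IsRelaxedSolution M C (V k) (Q k) 0 τ
  lipschitz : LipschitzWith M w
  tendsto : TendstoUniformlyOn V w atTop (Icc 0 τ)
  norm_eq : ∀ x ∈ Icc 0 τ, ‖w x‖ = 1
  error : Tendsto (fun k => Q k τ - Q k 0) atTop (𝓝 0)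

namespace IsNeutralLimit

variable {τ : ℝ} {V : ℕ → ℝ → Velocity n} {Q : ℕ → ℝ → ℝ} {w : ℝ → Velocity n}

/-- Contacts that are not neutral in the limit do not matter. -/
theorem exists_restrict (hM : N.ForceBound M) (h : N.IsNeutralLimit M C τ V Q w)
    {C₀ : Finset (Fin m)} (hC : C₀ ⊆ C) {s t : ℝ} (hs : 0 ≤ s) (hst : s ≤ t) (ht : t ≤ τ)
    (hw : ∀ x ∈ Icc s t, ∀ c ∈ C \ C₀, w x ∉ (N c).neutral) :
    ∃ Q' : ℕ → ℝ → ℝ, (∀ᶠ k in atTop, N.IsRelaxedSolution M C₀ (V k) (Q' k) s t) ∧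
      Tendsto (fun k => Q' k t - Q' k s) atTop (𝓝 0) := by
  have hsub : Icc s t ⊆ Icc 0 τ := Icc_subset_Icc hs ht
  obtain ⟨α, hα, hα0⟩ : ∃ α : ℝ, (∀ c ∈ C \ C₀, ∀ x ∈ Icc s t, α ≤ (N c).slip (w x)) ∧ 0 < α := by
    have : ∀ᶠ α : ℝ in 𝓝[>] 0, ∀ c ∈ C \ C₀, ∀ x ∈ Icc s t, α ≤ (N c).slip (w x) := by
      refine (Finset.eventually_all _).2 fun c hc => ?_
      obtain ⟨x₀, hx₀, hmin⟩ := isCompact_Icc.exists_isMinOn (nonempty_Icc.2 hst)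
        (((N c).continuous_slip.comp h.lipschitz.continuous).continuousOn (s := Icc s t))
      have hpos : 0 < (N c).slip (w x₀) := ((N c).slip_nonneg _).lt_of_ne fun h0 =>
        hw x₀ hx₀ c hc (Contact.slip_eq_zero_iff.1 h0.symm)
      filter_upwards [Ioo_mem_nhdsGT hpos] with α hα x hx
      exact hα.2.le.trans (hmin hx)
    exact (this.and self_mem_nhdsWithin).exists
  -- Eventually `V k` is so close to `w` that slips stay above `α / 2` and norms below `2`.
  refine ⟨fun k x => (1 + (α / 2)⁻¹ * (M * 2)) * Q k x - ((α / 2)⁻¹ / 2) * ‖V k x‖ ^ 2, ?_, ?_⟩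
  · have hM0 : (0 : ℝ) ≤ M := M.2
    have hε : 0 < min 1 (α / 2 / (M + 1)) := by positivity
    filter_upwards [Metric.tendstoUniformlyOn_iff.1 h.tendsto _ hε] with k hk
    refine ((h.solution k).mono hs hst ht).restrict hM hC (by positivity) (fun x hx => ?_)
      fun x hx c hc => ?_
    · have h1 := (hk x (hsub hx)).trans_le (min_le_left _ _)
      rw [dist_eq_norm, norm_sub_rev] at h1
      have h2 := norm_le_norm_add_norm_sub' (V k x) (w x)
      rw [h.norm_eq x (hsub hx)] at h2
      linarith
    · have h1 := (hk x (hsub hx)).trans_le (min_le_right _ _)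
      rw [dist_eq_norm, lt_div_iff₀ (by positivity)] at h1
      have h2 := Contact.slip_le_add (hM c) (V k x) (w x)
      have h3 := hα c hc x hx
      have h4 := norm_nonneg (w x - V k x)
      linarith
  · have hnorm : ∀ x ∈ Icc s t, Tendsto (fun k => ‖V k x‖ ^ 2) atTop (𝓝 1) := by
      intro x hx
      have := ((h.tendsto.tendsto_at (hsub hx)).norm).pow 2
      rwa [h.norm_eq x (hsub hx), one_pow] at this
    have hQ : Tendsto (fun k => Q k t - Q k s) atTop (𝓝 0) := by
      refine squeeze_zero (fun k => ?_) (fun k => ?_) h.error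
      · exact sub_nonneg.2 ((h.solution k).mono hs hst ht).error_le
      · have h1 := ((h.solution k).mono le_rfl hs (hst.trans ht)).error_le
        have h2 := ((h.solution k).mono (hs.trans hst) ht le_rfl).error_le
        linarith
    have := (hQ.const_mul (1 + (α / 2)⁻¹ * (M * 2))).sub
      (((hnorm t (right_mem_Icc.2 hst)).sub (hnorm s (left_mem_Icc.2 hst))).const_mul
        ((α / 2)⁻¹ / 2))
    simp only [sub_self, mul_zero] at this
    refine this.congr fun k => ?_
    ring

/-- The derivative `d` is neutral for the contacts neutral at `w x`, since a function has zero
derivative almost everywhere on its zero set. Just after `x` only these contacts matter, and they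
cannot change the component along `d`. Hence `⟪d, d⟫ = 0`. -/
theorem ae_hasDerivAt_zero (hM : N.ForceBound M) (h : N.IsNeutralLimit M C τ V Q w) :
    ∀ᵐ x, x ∈ Ico 0 τ → HasDerivAt w 0 x := by
  classical
  have h1 : ∀ᵐ x, ∀ c, ∀ d, ⟪(N c).normal, w x⟫_ℝ = 0 →
      HasDerivAt (fun x => ⟪(N c).normal, w x⟫_ℝ) d x → d = 0 :=
    ae_all_iff.2 fun c => ae_deriv_eq_zero_of_eq_zero _
  have h2 : ∀ᵐ x, ∀ c, ∀ d, (N c).frictionMap (w x) = 0 →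
      HasDerivAt (fun x => (N c).frictionMap (w x)) d x → d = 0 :=
    ae_all_iff.2 fun c => ae_deriv_eq_zero_of_eq_zero _
  filter_upwards [h1, h2, h.lipschitz.ae_differentiableAt] with x hx1 hx2 hdiff hx
  obtain ⟨d, hd⟩ : ∃ d, HasDerivAt w d x := ⟨_, hdiff.hasDerivAt⟩
  suffices d = 0 by rwa [← this]
  set C₀ := C.filter fun c => w x ∈ (N c).neutral with hC₀
  have hdC : d ∈ N.neutral C₀ := by
    refine mem_neutral.2 fun c hc => Contact.mem_neutral.2 ?_
    obtain ⟨hc1, hc2⟩ := Contact.mem_neutral.1 (Finset.mem_filter.1 hc).2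
    exact ⟨hx1 c _ hc1 ((innerSL ℝ (N c).normal).hasFDerivAt.comp_hasDerivAt x hd),
      hx2 c _ hc2 ((N c).frictionMap.hasFDerivAt.comp_hasDerivAt x hd)⟩
  obtain ⟨t, hxt, ht⟩ : ∃ t, x < t ∧ ∀ y ∈ Icc x t, y ≤ τ ∧ ∀ c ∈ C \ C₀, w y ∉ (N c).neutral := by
    have : ∀ᶠ y in 𝓝 x, y < τ ∧ ∀ c ∈ C \ C₀, w y ∉ (N c).neutral := by
      refine (eventually_lt_nhds hx.2).and ((Finset.eventually_all _).2 fun c hc => ?_)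
      have h0 : (N c).slip (w x) ≠ 0 := fun h0 => (Finset.mem_sdiff.1 hc).2
        (Finset.mem_filter.2 ⟨(Finset.mem_sdiff.1 hc).1, Contact.slip_eq_zero_iff.1 h0⟩)
      filter_upwards [((N c).continuous_slip.comp h.lipschitz.continuous).continuousAt.eventually_ne
        h0] with y hy hy'
      exact hy (Contact.slip_eq_zero_iff.2 hy')
    obtain ⟨δ, hδ, hball⟩ := Metric.eventually_nhds_iff.1 this
    refine ⟨x + δ / 2, by linarith, fun y hy => ?_⟩
    have := hball (y := y) (by
      rw [Real.dist_eq, abs_of_nonneg (sub_nonneg.2 hy.1)]; linarith [hy.2])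
    exact ⟨this.1.le, this.2⟩
  have hconst : ∀ y ∈ Icc x t, ⟪d, w y⟫_ℝ = ⟪d, w x⟫_ℝ := by
    intro y hy
    have hyτ := (ht y hy).1
    obtain ⟨Q', hsol, hQ'⟩ := h.exists_restrict hM (Finset.filter_subset _ _) hx.1 hy.1 hyτ
      fun z hz => (ht z ⟨hz.1, hz.2.trans hy.2⟩).2
    have hlim : Tendsto (fun k => |⟪d, V k y - V k x⟫_ℝ|) atTop (𝓝 |⟪d, w y - w x⟫_ℝ|) :=
      (tendsto_const_nhds.inner ((h.tendsto.tendsto_at ⟨hx.1.trans hy.1, hyτ⟩).sub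
        (h.tendsto.tendsto_at ⟨hx.1, hx.2.le⟩))).abs
    have hle : |⟪d, w y - w x⟫_ℝ| ≤ M * ‖d‖ * 0 :=
      le_of_tendsto_of_tendsto hlim (hQ'.const_mul _)
        (hsol.mono fun k hk => hk.inner_le_of_mem_neutral hdC)
    rw [mul_zero, abs_nonpos_iff, inner_sub_right, sub_eq_zero] at hle
    exact hle
  have hder : HasDerivWithinAt (fun y => ⟪d, w y⟫_ℝ) ⟪d, d⟫_ℝ (Ici x) x :=
    ((innerSL ℝ d).hasFDerivAt.comp_hasDerivAt x hd).hasDerivWithinAt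
  have hder' : HasDerivWithinAt (fun y => ⟪d, w y⟫_ℝ) 0 (Ici x) x := by
    refine (hasDerivWithinAt_const x _ ⟪d, w x⟫_ℝ).congr_of_eventuallyEq ?_ rfl
    filter_upwards [Icc_mem_nhdsGE hxt] with y hy using hconst y hy
  have := (uniqueDiffWithinAt_Ici x).eq_deriv _ hder hder'
  rwa [inner_self_eq_zero] at this

theorem eq_initial (hM : N.ForceBound M) (h : N.IsNeutralLimit M C τ V Q w) :
    ∀ x ∈ Icc 0 τ, w x = w 0 := by
  intro x hx
  have hac : AbsolutelyContinuousOnInterval w 0 x :=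
    h.lipschitz.lipschitzOnWith.absolutelyContinuousOnInterval
  obtain ⟨c, hc⟩ := hac.const_of_ae_hasDerivAt_zero (by
    have hne : ∀ᵐ y : ℝ, y ≠ τ := by simp [ae_iff]
    filter_upwards [h.ae_hasDerivAt_zero hM, hne] with y hy hyτ hyx
    rw [uIcc_of_le hx.1] at hyx
    exact hy ⟨hyx.1, (hyx.2.trans hx.2).lt_of_ne hyτ⟩)
  rw [hc x right_mem_uIcc, hc 0 left_mem_uIcc]

open Classical in
theorem exists_restrict_neutral (hM : N.ForceBound M) (h : N.IsNeutralLimit M C τ V Q w)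
    (hτ : 0 ≤ τ) : ∃ Q' : ℕ → ℝ → ℝ, (∀ᶠ k in atTop,
      N.IsRelaxedSolution M (C.filter fun c => w 0 ∈ (N c).neutral) (V k) (Q' k) 0 τ) ∧
      Tendsto (fun k => Q' k τ - Q' k 0) atTop (𝓝 0) :=
  h.exists_restrict hM (Finset.filter_subset _ _) le_rfl hτ le_rfl fun x hx _ hc hxc =>
    (Finset.mem_sdiff.1 hc).2 (Finset.mem_filter.2
      ⟨(Finset.mem_sdiff.1 hc).1, h.eq_initial hM x hx ▸ hxc⟩)

open Classical in
-- Contacts unable to balance would push the velocity along a fixed direction at a definite rate,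
-- but the limit does not move.
theorem degenerate (hM : N.ForceBound M) (h : N.IsNeutralLimit M C τ V Q w) (hτ : 0 < τ) :
    N.Degenerate (C.filter fun c => w 0 ∈ (N c).neutral) := by
  by_contra hdeg
  obtain ⟨Q', hQsol, hQ'⟩ := h.exists_restrict_neutral hM hτ.le
  obtain ⟨ξ, α, γ, hα, hpush⟩ := exists_inner_ge_of_not_degenerate M hdeg
  have hlim1 : Tendsto (fun k => ⟪ξ, V k τ - V k 0⟫_ℝ + γ * (Q' k τ - Q' k 0)) atTop
      (𝓝 (⟪ξ, w τ - w 0⟫_ℝ + γ * 0)) :=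
    (tendsto_const_nhds.inner ((h.tendsto.tendsto_at ⟨hτ.le, le_rfl⟩).sub
      (h.tendsto.tendsto_at ⟨le_rfl, hτ.le⟩))).add (hQ'.const_mul γ)
  have := ge_of_tendsto hlim1 (hQsol.mono fun k hk => hpush _ _ _ _ hk)
  rw [h.eq_initial hM τ ⟨hτ.le, le_rfl⟩, sub_self, inner_zero_right, mul_zero, add_zero,
    sub_zero] at this
  exact absurd this (not_le.2 (mul_pos hα hτ))

end IsNeutralLimit

/-- Penetrating relaxed solutions driven by the contacts in `C` terminate in a time proportional to
the initial velocity and the accumulated error. -/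
def TerminatesInLinearTime (N : ContactSet n m) (M : ℝ≥0) (C : Finset (Fin m)) : Prop :=
  ∃ K : ℝ, 0 ≤ K ∧ ∀ v R T, N.IsRelaxedSolution M C v R 0 T →
    (∀ x ∈ Icc 0 T, v x ∈ N.penetrating) → T ≤ K * (‖v 0‖ + (R T - R 0))

open Classical in
-- Subtracting `w 0` preserves both penetration and the relaxed inclusion. The shifted initial
-- velocities tend to 0 while the duration stays `τ`.
theorem IsNeutralLimit.not_terminatesInLinearTime (hM : N.ForceBound M) {τ : ℝ}
    {V : ℕ → ℝ → Velocity n} {Q : ℕ → ℝ → ℝ} {w : ℝ → Velocity n}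
    (h : N.IsNeutralLimit M C τ V Q w) (hτ : 0 < τ)
    (hpen : ∀ k, ∀ x ∈ Icc 0 τ, V k x ∈ N.penetrating)
    (hnormal : ∀ c, ⟪(N c).normal, w 0⟫_ℝ = 0) :
    ¬ N.TerminatesInLinearTime M (C.filter fun c => w 0 ∈ (N c).neutral) := by
  rintro ⟨K, hK, hterm⟩
  obtain ⟨Q', hQsol, hQ'⟩ := h.exists_restrict_neutral hM hτ.le
  have hneg : -w 0 ∈ N.neutral (C.filter fun c => w 0 ∈ (N c).neutral) :=
    Submodule.neg_mem _ (mem_neutral.2 fun c hc => (Finset.mem_filter.1 hc).2)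
  have hlim : Tendsto (fun k => K * (‖V k 0 + -w 0‖ + (Q' k τ - Q' k 0))) atTop
      (𝓝 (K * (‖w 0 + -w 0‖ + 0))) :=
    ((((h.tendsto.tendsto_at ⟨le_rfl, hτ.le⟩).add_const (-w 0)).norm).add hQ').const_mul K
  have hev : ∀ᶠ k in atTop, τ ≤ K * (‖V k 0 + -w 0‖ + (Q' k τ - Q' k 0)) := by
    filter_upwards [hQsol] with k hk
    refine hterm (fun x => V k x + -w 0) (Q' k) τ (hk.add_const hneg) fun x hx => ?_
    obtain ⟨c, hc⟩ := hpen k x hx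
    refine ⟨c, ?_⟩
    rwa [inner_add_right, inner_neg_right, hnormal c, neg_zero, add_zero]
  have := ge_of_tendsto hlim hev
  rw [add_neg_cancel, norm_zero, add_zero, mul_zero] at this
  exact absurd this (not_le.2 hτ)

theorem ne_zero_of_mem_penetrating {u : Velocity n} (hu : u ∈ N.penetrating) : u ≠ 0 := by
  rintro rfl
  obtain ⟨c, hc⟩ := hu
  simp at hc

/-- Energy is dissipated at a uniform rate unless the velocity is almost neutral for contacts that
balance each other; such velocities are excluded if those contacts terminate. -/
theorem exists_norm_contraction (hM : N.ForceBound M) (U : Submodule ℝ (Velocity n))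
    (hU : ∀ u ∈ U, ‖u‖ = 1 → ∀ C₀ ⊆ C, (∀ c ∈ C, c ∈ C₀ ↔ u ∈ (N c).neutral) → N.Degenerate C₀ →
      (∀ c, ⟪(N c).normal, u⟫_ℝ = 0) ∧ N.TerminatesInLinearTime M C₀) {τ : ℝ} (hτ : 0 < τ) :
    ∃ η : ℝ, 0 < η ∧ η < 1 ∧ ∀ v R, N.IsRelaxedSolution M C v R 0 τ → (∀ x ∈ Icc 0 τ, v x ∈ U) →
      (∀ x ∈ Icc 0 τ, v x ∈ N.penetrating) → ‖v 0‖ = 1 → R τ - R 0 ≤ η → ‖v τ‖ ≤ 1 - η := by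
  classical
  by_contra! hcon
  -- The shift by two keeps `η 0` below 1. The same `η k` bounds the error and the loss of norm, so
  -- all norms on `[0, τ]` are squeezed to 1.
  let η : ℕ → ℝ := fun k => 1 / ((k : ℝ) + 1 + 1)
  have hη0 : ∀ k, 0 < η k := fun k => by positivity
  have hη1 : ∀ k, η k < 1 := fun k => by
    have : (0 : ℝ) ≤ k := k.cast_nonneg
    rw [div_lt_one (by positivity)]; linarith
  have hηlim : Tendsto η atTop (𝓝 0) := by
    have := (tendsto_add_atTop_iff_nat 1).2 (tendsto_one_div_add_atTop_nhds_zero_nat (𝕜 := ℝ))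
    simpa [η] using this
  choose v R hsol hvU hpen hv0 hR hvτ using fun k => hcon (η k) (hη0 k) (hη1 k)
  have hM0 : (0 : ℝ) ≤ M := M.2
  have hτ0 : (0 : ℝ) ∈ Icc 0 τ := ⟨le_rfl, hτ.le⟩
  have hττ : τ ∈ Icc 0 τ := ⟨hτ.le, le_rfl⟩
  have hupper : ∀ k, ∀ x ∈ Icc 0 τ, ‖v k x‖ ≤ 1 + M * η k := by
    intro k x hx
    have h1 := ((hsol k).mono le_rfl hx.1 hx.2).norm_le fun y hy =>
      ne_zero_of_mem_penetrating (hpen k y ⟨hy.1, hy.2.trans hx.2⟩)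
    have h2 := ((hsol k).mono hx.1 hx.2 le_rfl).error_le
    rw [hv0] at h1
    have := mul_le_mul_of_nonneg_left (by linarith [hR k] : R k x - R k 0 ≤ η k) hM0
    linarith
  have hlower : ∀ k, ∀ x ∈ Icc 0 τ, 1 - η k - M * η k ≤ ‖v k x‖ := by
    intro k x hx
    have h1 := ((hsol k).mono hx.1 hx.2 le_rfl).norm_le fun y hy =>
      ne_zero_of_mem_penetrating (hpen k y ⟨hx.1.trans hy.1, hy.2⟩)
    have h2 := ((hsol k).mono le_rfl hx.1 hx.2).error_le
    have := mul_le_mul_of_nonneg_left (by linarith [hR k] : R k τ - R k x ≤ η k) hM0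
    linarith [hvτ k]
  obtain ⟨φ, w, hφ, hw, hlim⟩ := exists_subseq_tendstoUniformlyOn_of_lipschitz hτ.le v
    (fun k => (hsol k).lipschitz) (B := 1 + M) fun k x hx => (hupper k x hx).trans (by
      have := mul_le_mul_of_nonneg_left (hη1 k).le hM0
      linarith)
  have hηφ := hηlim.comp hφ.tendsto_atTop
  have hwnorm : ∀ x ∈ Icc 0 τ, ‖w x‖ = 1 := by
    intro x hx
    refine tendsto_nhds_unique (hlim.tendsto_at hx).norm ?_
    refine tendsto_of_tendsto_of_tendsto_of_le_of_le (g := fun k => 1 - η (φ k) - M * η (φ k))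
      (h := fun k => 1 + M * η (φ k)) ?_ ?_ (fun k => hlower _ x hx) (fun k => hupper _ x hx)
    · simpa using (hηφ.const_sub 1).sub (hηφ.const_mul (M : ℝ))
    · simpa using (hηφ.const_mul (M : ℝ)).const_add 1
  have h : N.IsNeutralLimit M C τ (fun k => v (φ k)) (fun k => R (φ k)) w :=
    { solution := fun k => hsol _
      lipschitz := hw
      tendsto := hlim
      norm_eq := hwnorm
      error := squeeze_zero (fun k => sub_nonneg.2 (hsol _).error_le) (fun k => hR _) hηφ }
  have huU : w 0 ∈ U := U.closed_of_finiteDimensional.mem_of_tendsto (hlim.tendsto_at hτ0)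
    (Eventually.of_forall fun k => hvU _ _ hτ0)
  obtain ⟨hnormal, hterm⟩ := hU _ huU (hwnorm 0 hτ0) _
    (Finset.filter_subset (fun c => w 0 ∈ (N c).neutral) C) (fun c hc => by simp [hc])
    (h.degenerate hM hτ)
  exact h.not_terminatesInLinearTime hM hτ (fun k => hpen _) hnormal hterm

end ContactSet

/-! ### Termination -/

namespace ContactSet

variable {n m : ℕ} {N : ContactSet n m} {M : ℝ≥0} {C : Finset (Fin m)}

theorem smul_mem_penetrating {u : Velocity n} {σ : ℝ} (hσ : 0 < σ) (hu : u ∈ N.penetrating) :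
    σ • u ∈ N.penetrating := by
  obtain ⟨c, hc⟩ := hu
  exact ⟨c, by rw [inner_smul_right]; exact mul_neg_of_pos_of_neg hσ hc⟩

/-- A uniform relative energy loss per unit of rescaled time bounds the time of penetration. -/
theorem le_of_norm_contraction {U : Submodule ℝ (Velocity n)} {η : ℝ} (hη0 : 0 < η) (hη1 : η < 1)
    (hη : ∀ v R, N.IsRelaxedSolution M C v R 0 1 → (∀ x ∈ Icc (0 : ℝ) 1, v x ∈ U) →
      (∀ x ∈ Icc (0 : ℝ) 1, v x ∈ N.penetrating) → ‖v 0‖ = 1 → R 1 - R 0 ≤ η → ‖v 1‖ ≤ 1 - η)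
    {v : ℝ → Velocity n} {R : ℝ → ℝ} {T : ℝ} (hv : N.IsRelaxedSolution M C v R 0 T)
    (hvU : ∀ x ∈ Icc 0 T, v x ∈ U) (hpen : ∀ x ∈ Icc 0 T, v x ∈ N.penetrating) :
    T ≤ η⁻¹ * (M + 1) * (‖v 0‖ + (R T - R 0)) := by
  have hM0 : (0 : ℝ) ≤ M := M.2
  have hstep : ∀ t, 0 ≤ t → t + ‖v t‖ ≤ T →
      ‖v (t + ‖v t‖)‖ ≤ (1 - η) * ‖v t‖ + (M + 1) * (R (t + ‖v t‖) - R t) := by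
    intro t ht htT
    set σ := ‖v t‖ with hσ
    have htT' : t ≤ T := (le_add_of_nonneg_right (norm_nonneg _)).trans htT
    have hpos : 0 < σ := norm_pos_iff.2 (ne_zero_of_mem_penetrating (hpen t ⟨ht, htT'⟩))
    have hsol := hv.mono ht (by linarith : t ≤ t + σ) htT
    have hinc := hsol.error_le
    -- With small error, rescaling by `σ` gives the contraction. Otherwise the error exceeds `η * σ`
    -- and one extra unit in `M + 1` absorbs the missing loss.
    rcases le_or_gt (R (t + σ) - R t) (η * σ) with hR | hR
    · have hmem : ∀ x ∈ Icc (0 : ℝ) 1, t + σ * x ∈ Icc 0 T := fun x hx =>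
        ⟨by have := mul_nonneg hpos.le hx.1; linarith,
          by have := mul_le_mul_of_nonneg_left hx.2 hpos.le; linarith⟩
      have := hη _ _ (IsRelaxedSolution.rescale hpos (τ := 1) (by rwa [mul_one]))
        (fun x hx => U.smul_mem _ (hvU _ (hmem x hx)))
        (fun x hx => smul_mem_penetrating (by positivity) (hpen _ (hmem x hx)))
        (by rw [mul_zero, add_zero, norm_smul, norm_inv, ← hσ, norm_norm,
          inv_mul_cancel₀ hpos.ne'])
        (by rw [mul_zero, add_zero, mul_one, ← mul_sub, inv_mul_le_iff₀ hpos]; linarith)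
      rw [mul_one, norm_smul, norm_inv, Real.norm_of_nonneg hpos.le, inv_mul_le_iff₀ hpos] at this
      have h2 := mul_nonneg (by positivity : (0 : ℝ) ≤ M + 1) (sub_nonneg.2 hinc)
      linarith
    · have := hsol.norm_le fun x hx => ne_zero_of_mem_penetrating
        (hpen x ⟨ht.trans hx.1, hx.2.trans htT⟩)
      rw [← hσ] at this
      linarith
  -- A step from `t` lasts `‖v t‖` and loses `η * ‖v t‖` up to error, so the left side does not
  -- increase over a step. The latest time in `Z` replaces an iteration: a step from it must
  -- overshoot `T`.
  let Z : Set ℝ := {t | t ∈ Icc 0 T ∧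
    η * t + ‖v t‖ - (M + 1) * R t ≤ ‖v 0‖ - (M + 1) * R 0}
  have hcont : ContinuousOn (fun t => η * t + ‖v t‖ - (M + 1) * R t) (Icc 0 T) := by
    have h1 := hv.lipschitz.continuousOn
    have h2 := hv.ac.continuousOn
    rw [uIcc_of_le hv.le] at h2
    fun_prop
  have hZ : IsCompact Z := isCompact_Icc.of_isClosed_subset
    (hcont.preimage_isClosed_of_isClosed isClosed_Icc isClosed_Iic) fun t ht => ht.1
  have h0Z : (0 : ℝ) ∈ Z := ⟨⟨le_rfl, hv.le⟩, by simp⟩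
  obtain ⟨t, ⟨htI, htZ⟩, hmax⟩ := hZ.exists_isGreatest ⟨0, h0Z⟩
  have hpos : 0 < ‖v t‖ := norm_pos_iff.2 (ne_zero_of_mem_penetrating (hpen t htI))
  have hexit : T < t + ‖v t‖ := by
    by_contra! hle
    have hmem : t + ‖v t‖ ∈ Z := by
      refine ⟨⟨by linarith [htI.1], hle⟩, ?_⟩
      have := hstep t htI.1 hle
      linarith
    have := hmax hmem
    linarith
  have hRt := (hv.mono htI.1 htI.2 le_rfl).error_le
  have h1 := mul_le_mul_of_nonneg_left hRt (by positivity : (0 : ℝ) ≤ M + 1)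
  have h2 := mul_le_mul_of_nonneg_right hη1.le (norm_nonneg (v t))
  have h3 := mul_le_mul_of_nonneg_left hexit.le hη0.le
  have h4 := mul_nonneg hM0 (norm_nonneg (v 0))
  rw [mul_assoc, le_inv_mul_iff₀ hη0]
  linarith

/-- Induction over the set of contacts that drive the motion. -/
theorem terminatesInLinearTime (hM : N.ForceBound M) {C₁ : Finset (Fin m)}
    (hN : ∀ C ⊆ C₁, N.Degenerate C → ∀ u ∈ N.neutral C, ∀ c, ⟪(N c).normal, u⟫_ℝ = 0)
    (C : Finset (Fin m)) (hC : C ⊆ C₁) : N.TerminatesInLinearTime M C := by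
  induction C using Finset.strongInduction with
  | H C ih =>
  -- Disjointness rules out `C₀ = C`, as a unit vector of `U` would be neutral for all of `C`; so
  -- the induction hypothesis applies to `C₀`.
  have hU : ∀ U : Submodule ℝ (Velocity n), (N.Degenerate C → Disjoint (N.neutral C) U) →
      ∀ u ∈ U, ‖u‖ = 1 → ∀ C₀ ⊆ C, (∀ c ∈ C, c ∈ C₀ ↔ u ∈ (N c).neutral) → N.Degenerate C₀ →
      (∀ c, ⟪(N c).normal, u⟫_ℝ = 0) ∧ N.TerminatesInLinearTime M C₀ := by
    intro U hdisj u hu hu1 C₀ hC₀ hiff hdeg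
    have huC₀ : u ∈ N.neutral C₀ := mem_neutral.2 fun c hc => (hiff c (hC₀ hc)).1 hc
    refine ⟨hN C₀ (hC₀.trans hC) hdeg u huC₀, ih C₀ (hC₀.ssubset_of_ne ?_) (hC₀.trans hC)⟩
    rintro rfl
    rw [Submodule.disjoint_def.1 (hdisj hdeg) u huC₀ hu, norm_zero] at hu1
    exact zero_ne_one hu1
  have hM0 : (0 : ℝ) ≤ M := M.2
  by_cases hdeg : N.Degenerate C
  -- When `C` itself can balance, the motion is projected off its neutral space. All normals vanish
  -- on that space, so penetration survives.
  · obtain ⟨η, hη0, hη1, hη⟩ := exists_norm_contraction hM (N.neutral C)ᗮ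
      (hU _ fun _ => Submodule.orthogonal_disjoint _) one_pos
    refine ⟨η⁻¹ * (M + 1), by positivity, fun v R T hv hpen => ?_⟩
    refine (le_of_norm_contraction hη0 hη1 hη hv.starProjection
      (fun x _ => Submodule.starProjection_apply_mem _ _) fun x hx => ?_).trans ?_
    · obtain ⟨c, hc⟩ := hpen x hx
      refine ⟨c, ?_⟩
      have h1 := hN C hC hdeg _ ((N.neutral C).starProjection_apply_mem (v x)) c
      rw [Submodule.starProjection_orthogonal']
      simpa [inner_sub_right, h1] using hc
    · gcongr
      exact Submodule.norm_starProjection_apply_le _ _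
  · obtain ⟨η, hη0, hη1, hη⟩ := exists_norm_contraction hM ⊤
      (hU _ fun h => absurd h hdeg) one_pos
    exact ⟨η⁻¹ * (M + 1), by positivity, fun v R T hv hpen =>
      le_of_norm_contraction hη0 hη1 hη hv (fun _ _ => Submodule.mem_top) hpen⟩

end ContactSet

/-! ### The multi-contact inclusion -/

theorem norm_le_one_of_mem_unitDir {u w : EuclideanSpace ℝ (Fin 2)} (hw : w ∈ unitDir u) :
    ‖w‖ ≤ 1 := by
  rcases hw with ⟨hu, rfl⟩ | ⟨-, hw⟩
  · rw [norm_smul, norm_inv, norm_norm, inv_mul_cancel₀ (norm_ne_zero_iff.2 hu)]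
  · exact hw

theorem inner_eq_norm_of_mem_unitDir {u w : EuclideanSpace ℝ (Fin 2)} (hw : w ∈ unitDir u) :
    ⟪w, u⟫_ℝ = ‖u‖ := by
  rcases hw with ⟨hu, rfl⟩ | ⟨rfl, -⟩
  · rw [real_inner_smul_left, real_inner_self_eq_norm_sq, sq,
      inv_mul_cancel_left₀ (norm_ne_zero_iff.2 hu)]
  · simp

theorem unitDir_nonempty (u : EuclideanSpace ℝ (Fin 2)) : (unitDir u).Nonempty := by
  by_cases hu : u = 0
  · exact ⟨0, Or.inr ⟨hu, by simp⟩⟩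
  · exact ⟨_, Or.inl ⟨hu, rfl⟩⟩

namespace Contact

variable {n : ℕ} {c : Contact n} {v : Velocity n}

theorem normal_ne_zero_of_mem_closure (hv : v ∈ closure c.penetrating) : c.normal ≠ 0 := by
  intro h
  simp [penetrating, h] at hv

theorem inner_nonpos_of_mem_closure (hv : v ∈ closure c.penetrating) : ⟪c.normal, v⟫_ℝ ≤ 0 := by
  have hcl : IsClosed {v : Velocity n | ⟪c.normal, v⟫_ℝ ≤ 0} :=
    isClosed_le (by fun_prop) continuous_const
  exact closure_minimal (fun u (hu : ⟪c.normal, u⟫_ℝ < 0) => hu.le) hcl hv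

theorem mem_closure_penetrating (hc : c.normal ≠ 0) (hv : ⟪c.normal, v⟫_ℝ = 0) :
    v ∈ closure c.penetrating := by
  have hlim : Tendsto (fun ε : ℝ => v - ε • c.normal) (𝓝[>] 0) (𝓝 v) := by
    have : Tendsto (fun ε : ℝ => v - ε • c.normal) (𝓝 0) (𝓝 (v - (0 : ℝ) • c.normal)) :=
      Continuous.tendsto (by fun_prop) 0
    rw [zero_smul, sub_zero] at this
    exact this.mono_left nhdsWithin_le_nhds
  refine mem_closure_of_tendsto hlim ?_
  filter_upwards [self_mem_nhdsWithin] with ε (hε : 0 < ε)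
  have : 0 < ⟪c.normal, c.normal⟫_ℝ := real_inner_self_pos.2 hc
  simp only [penetrating, mem_ofPred_eq, inner_sub_right, hv, inner_smul_right, zero_sub,
    neg_neg_iff_pos]
  positivity

theorem exists_admissible_of_mem_netForce (hv : v ∈ closure c.penetrating) {f : Velocity n}
    (hf : f ∈ c.netForce v) : ∃ y, c.Admissible v 1 y ∧ f = c.force 1 y := by
  obtain ⟨w, hw, rfl⟩ := hf
  refine ⟨w, ⟨zero_le_one, norm_le_one_of_mem_unitDir hw, ?_,
    fun _ => inner_nonpos_of_mem_closure hv⟩, ?_⟩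
  · simp [frictionMap, inner_smul_right, inner_eq_norm_of_mem_unitDir hw, norm_smul,
      abs_of_nonneg c.mu_nonneg]
  · simp [force, frictionMap]

/-- Either `mu = 0` and friction is absent, or the contact sticks and any vector of the unit disc is
allowed. -/
theorem force_one_mem_netForce (hv : v ∈ c.neutral) {y : EuclideanSpace ℝ (Fin 2)}
    (hy : ‖y‖ ≤ 1) : c.force 1 y ∈ c.netForce v := by
  have h0 : c.mu • c.tangent v = 0 := (mem_neutral.1 hv).2
  rcases smul_eq_zero.1 h0 with h | h
  · obtain ⟨w, hw⟩ := unitDir_nonempty (c.tangent v)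
    exact ⟨w, hw, by simp [force, frictionMap, h]⟩
  · exact ⟨y, Or.inr ⟨h, hy⟩, by simp [force, frictionMap]⟩

end Contact

namespace ContactSet

variable {n m : ℕ} {N : ContactSet n m} {M : ℝ≥0}

open Classical in
/-- The contacts that can be penetrated at all. -/
noncomputable def proper (N : ContactSet n m) : Finset (Fin m) :=
  Finset.univ.filter fun c => (N c).normal ≠ 0

theorem mem_proper {c : Fin m} : c ∈ N.proper ↔ (N c).normal ≠ 0 := by
  simp [proper]

/-- At a fixed velocity, Coulomb's law is closed under nonnegative combinations, so it passes to the
convex hull. -/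
theorem exists_admissible_of_mem_netForce {v d : Velocity n} (hd : d ∈ N.netForce v) :
    ∃ (l : Fin m → ℝ) (y : Fin m → EuclideanSpace ℝ (Fin 2)),
      (∀ c ∈ N.proper, (N c).Admissible v (l c) (y c)) ∧ ∑ c ∈ N.proper, l c = 1 ∧
        d = N.force N.proper l y := by
  classical
  let S : Set (Velocity n) := {d | ∃ (l : Fin m → ℝ) (y : Fin m → EuclideanSpace ℝ (Fin 2)),
    (∀ c ∈ N.proper, (N c).Admissible v (l c) (y c)) ∧ ∑ c ∈ N.proper, l c = 1 ∧
      d = N.force N.proper l y}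
  have hconv : Convex ℝ S := by
    rintro _ ⟨l, y, hly, hl, rfl⟩ _ ⟨l', y', hly', hl', rfl⟩ s t hs ht hst
    refine ⟨fun c => s * l c + t * l' c, fun c => s • y c + t • y' c, fun c hc => ?_, ?_, ?_⟩
    · obtain ⟨h0, h1, h2, h3⟩ := hly c hc
      obtain ⟨h0', h1', h2', h3'⟩ := hly' c hc
      refine ⟨by positivity, ?_, ?_, fun hne => ?_⟩
      · refine (norm_add_le _ _).trans ?_
        rw [norm_smul, norm_smul, Real.norm_of_nonneg hs, Real.norm_of_nonneg ht]
        exact add_le_add (mul_le_mul_of_nonneg_left h1 hs) (mul_le_mul_of_nonneg_left h1' ht)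
      · rw [inner_add_left, real_inner_smul_left, real_inner_smul_left, h2, h2']
        ring
      · by_contra hpos
        exact hne (by simp [not_ne_iff.1 (mt h3 hpos), not_ne_iff.1 (mt h3' hpos)])
    · rw [Finset.sum_add_distrib, ← Finset.mul_sum, ← Finset.mul_sum, hl, hl', mul_one, mul_one,
        hst]
    · simp only [force, Finset.smul_sum, ← Finset.sum_add_distrib, Contact.force, smul_sub,
        smul_smul, add_smul, map_add, map_smul]
      exact Finset.sum_congr rfl fun c _ => by abel
  suffices h : N.netForce v ⊆ S from h hd
  refine convexHull_min ?_ hconv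
  rintro f ⟨i, hi, hf⟩
  obtain ⟨y, hy, rfl⟩ := Contact.exists_admissible_of_mem_netForce hi hf
  have hip : i ∈ N.proper := mem_proper.2 (Contact.normal_ne_zero_of_mem_closure hi)
  refine ⟨Pi.single i 1, Pi.single i y, fun c _ => ?_, ?_, ?_⟩
  · rcases eq_or_ne c i with rfl | hci
    · simpa using hy
    · simp [hci, Contact.Admissible]
  · rw [Finset.sum_pi_single', if_pos hip]
  · rw [force, Finset.sum_eq_single_of_mem i hip fun c _ hci => by simp [hci, Contact.force]]
    simp

theorem notMem_separating_of_mem_penetrating {v : Velocity n} (hv : v ∈ N.penetrating) :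
    v ∉ N.separating := fun h => interior_subset h hv

theorem derivMap_eq_netForce {v : Velocity n} (hv : v ∈ N.penetrating) :
    N.derivMap v = N.netForce v := by
  rw [derivMap, if_neg (notMem_separating_of_mem_penetrating hv), if_pos hv]

/-- At a neutral velocity every contact of `C` is in the closure of its penetrating set and has its
whole friction disc available, so the balancing weights form a convex combination of net forces. -/
theorem zero_mem_netForce_of_degenerate {C : Finset (Fin m)} (hC : C ⊆ N.proper)
    (hdeg : N.Degenerate C) {u : Velocity n} (hu : u ∈ N.neutral C) : 0 ∈ N.netForce u := by
  obtain ⟨l, y, hly, hl, h0⟩ := hdeg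
  let f : Fin m → Velocity n := fun c => (N c).force 1 ((l c)⁻¹ • y c)
  have hsum : ∑ c ∈ C, l c • f c = 0 := by
    rw [← h0, force]
    refine Finset.sum_congr rfl fun c hc => ?_
    rcases eq_or_ne (l c) 0 with h | h
    · have hy : y c = 0 := norm_le_zero_iff.1 ((hly c hc).2.trans_eq h)
      simp [Contact.force, h, hy]
    · simp [f, Contact.force, smul_sub, smul_smul, h]
  rw [← hsum]
  refine (convex_convexHull ℝ _).sum_mem (fun c hc => (hly c hc).1) hl fun c hc => ?_
  refine subset_convexHull ℝ _ ⟨c, ?_, ?_⟩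
  · exact Contact.mem_closure_penetrating (mem_proper.1 (hC hc))
      (Contact.mem_neutral.1 (mem_neutral.1 hu c hc)).1
  · refine Contact.force_one_mem_netForce (mem_neutral.1 hu c hc) ?_
    rw [norm_smul, norm_inv, Real.norm_of_nonneg (hly c hc).1]
    exact inv_mul_le_one_of_le₀ (hly c hc).2 (hly c hc).1

/-- No neutral velocity of a balancing set can penetrate, and the neutral space contains `-u` along
with `u`. -/
theorem Nondegenerate.inner_normal_eq_zero (hN : N.Nondegenerate) {C : Finset (Fin m)}
    (hC : C ⊆ N.proper) (hdeg : N.Degenerate C) {u : Velocity n} (hu : u ∈ N.neutral C)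
    (c : Fin m) : ⟪(N c).normal, u⟫_ℝ = 0 := by
  have key : ∀ u ∈ N.neutral C, 0 ≤ ⟪(N c).normal, u⟫_ℝ := fun u hu =>
    not_lt.1 fun hlt => hN u ⟨c, hlt⟩ (zero_mem_netForce_of_degenerate hC hdeg hu)
  have h := key (-u) (Submodule.neg_mem _ hu)
  rw [inner_neg_right, neg_nonneg] at h
  exact le_antisymm h (key u hu)

theorem isRelaxedSolution_of_isSolution (hM : N.ForceBound M) {v : ℝ → Velocity n} {T : ℝ}
    (hT : 0 ≤ T) (hv : IsSolution N.derivMap 0 T v) (hpen : ∀ x ∈ Icc 0 T, v x ∈ N.penetrating) :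
    N.IsRelaxedSolution M N.proper v 0 0 T := by
  have hd : ∀ᵐ x, x ∈ Icc 0 T → ∃ d, HasDerivAt v d x ∧ ‖d‖ ≤ M ∧
      N.IsRelaxedForce M N.proper (v x) d 0 := by
    have h := (ae_restrict_iff' measurableSet_Icc).1 hv.2
    filter_upwards [h] with x hx hxT
    obtain ⟨d, hd, hder⟩ := hx hxT
    rw [derivMap_eq_netForce (hpen x hxT)] at hd
    obtain ⟨l, y, hly, hl, rfl⟩ := exists_admissible_of_mem_netForce hd
    refine ⟨_, hder, ?_, le_rfl, l, y, hly, by simp [hl], by simp⟩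
    calc ‖N.force N.proper l y‖ ≤ ∑ c ∈ N.proper, M * l c :=
          norm_sum_le_of_le _ fun c hc => Contact.norm_force_le (hM c) (hly c hc).2.1
      _ = M := by rw [← Finset.mul_sum, hl, mul_one]
  refine ⟨hT, hv.1.lipschitzOnWith_of_ae_deriv_le ?_, ?_, ?_⟩
  · filter_upwards [hd] with x hx hxT
    obtain ⟨d, h1, h2, -⟩ := hx hxT
    exact ⟨d, h1, h2⟩
  · exact (LipschitzWith.const (0 : ℝ)).lipschitzOnWith.absolutelyContinuousOnInterval
  · filter_upwards [hd] with x hx hxT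
    obtain ⟨d, h1, -, h3⟩ := hx hxT
    exact ⟨d, 0, h1, hasDerivAt_const x 0, h3⟩

theorem Nondegenerate.dissipative (hN : N.Nondegenerate) : N.Dissipative := by
  classical
  obtain ⟨M, hM⟩ := N.exists_forceBound
  have hex : ∀ s : ℝ, 0 < s → ∃ η : ℝ, 0 < η ∧ η < 1 ∧ ∀ v : ℝ → Velocity n,
      IsSolution N.derivMap 0 s v → (∀ r ∈ Icc 0 s, v r ∈ N.penetrating) → ‖v 0‖ = 1 →
        ‖v s‖ ≤ 1 - η := by
    intro s hs
    obtain ⟨η, hη0, hη1, hη⟩ := exists_norm_contraction (C := N.proper) hM ⊤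
      (fun u _ _ C₀ hC₀ hiff hdeg =>
        ⟨hN.inner_normal_eq_zero hC₀ hdeg
          (mem_neutral.2 fun c hc => (hiff c (hC₀ hc)).1 hc),
        terminatesInLinearTime hM
          (fun _ hC hdeg _ hu c => hN.inner_normal_eq_zero hC hdeg hu c) C₀ hC₀⟩) hs
    exact ⟨η, hη0, hη1, fun v hv hpen hv0 =>
      hη v 0 (isRelaxedSolution_of_isSolution hM hs.le hv hpen) (fun _ _ => Submodule.mem_top) hpen
        hv0 (by simpa using hη0.le)⟩
  choose! β hβ0 hβ1 hβ using hex
  -- The value 0 at `s = 0` keeps the function in `[0, 1)`, since the chosen `β` is controlled only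
  -- for positive times.
  refine ⟨fun s => if 0 < s then β s else 0, fun s _ => ?_, fun s hs => ?_,
    fun s hs v hv hpen hv0 => ?_⟩
  · by_cases h : 0 < s
    · simpa [h] using ⟨(hβ0 s h).le, hβ1 s h⟩
    · simp [h]
  · simpa [hs] using hβ0 s hs
  · simpa [hs] using hβ s hs v hv hpen hv0

theorem netForce_smul {v : Velocity n} {σ : ℝ} (hσ : 0 < σ) :
    N.netForce v ⊆ N.netForce (σ • v) := by
  refine convexHull_mono ?_
  rintro f ⟨i, hi, w, hw, rfl⟩
  refine ⟨i, ?_, w, ?_, rfl⟩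
  · refine map_mem_closure (continuous_const_smul σ) hi fun u (hu : ⟪_, u⟫_ℝ < 0) => ?_
    change ⟪_, σ • u⟫_ℝ < 0
    rw [inner_smul_right]
    exact mul_neg_of_pos_of_neg hσ hu
  · rw [map_smul]
    rcases hw with ⟨hu, rfl⟩ | ⟨hu, hw⟩
    · refine Or.inl ⟨smul_ne_zero hσ.ne' hu, ?_⟩
      rw [norm_smul, Real.norm_of_nonneg hσ.le, smul_smul]
      congr 1
      field_simp
    · exact Or.inr ⟨by rw [hu, smul_zero], hw⟩

theorem Dissipative.nondegenerate (hN : N.Dissipative) : N.Nondegenerate := by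
  obtain ⟨β, -, hβ, h⟩ := hN
  intro v hv h0
  have hpos : 0 < ‖v‖ := norm_pos_iff.2 (ne_zero_of_mem_penetrating hv)
  set u := ‖v‖⁻¹ • v with hu
  have hupen : u ∈ N.penetrating := smul_mem_penetrating (by positivity) hv
  have hu1 : ‖u‖ = 1 := by
    rw [hu, norm_smul, norm_inv, norm_norm, inv_mul_cancel₀ hpos.ne']
  have := h 1 one_pos (fun _ => u) ⟨(LipschitzWith.const
    u).lipschitzOnWith.absolutelyContinuousOnInterval, ae_of_all _ fun x =>
      ⟨0, by rw [derivMap_eq_netForce hupen]; exact netForce_smul (by positivity) h0,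
        hasDerivAt_const x u⟩⟩ (fun _ _ => hupen) hu1
  rw [hu1] at this
  linarith [hβ 1 one_pos]

theorem Nondegenerate.exists_exit_time (hN : N.Nondegenerate) :
    ∃ S : ℝ, 0 < S ∧ ∀ v : ℝ → Velocity n, IsSolution N.derivMap 0 (S * ‖v 0‖) v →
      ∃ s ∈ Icc 0 (S * ‖v 0‖), v s ∉ N.penetrating := by
  obtain ⟨M, hM⟩ := N.exists_forceBound
  obtain ⟨K, hK, h⟩ := terminatesInLinearTime hM
    (fun _ hC hdeg _ hu c => hN.inner_normal_eq_zero hC hdeg hu c) N.proper subset_rfl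
  -- A penetrating motion has `‖v 0‖ > 0`, so lasting `(K + 1) * ‖v 0‖` contradicts the bound `K *
  -- ‖v 0‖`.
  refine ⟨K + 1, by positivity, fun v hv => ?_⟩
  by_contra! hpen
  have hT : 0 ≤ (K + 1) * ‖v 0‖ := by positivity
  have h1 := h v 0 _ (isRelaxedSolution_of_isSolution hM hT hv hpen) hpen
  have h2 : 0 < ‖v 0‖ := norm_pos_iff.2 (ne_zero_of_mem_penetrating (hpen 0 ⟨le_rfl, hT⟩))
  simp only [Pi.zero_apply, sub_self, add_zero] at h1
  linarith

end ContactSet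

/-- For every contact set, nondegeneracy is equivalent to dissipativity, and for a nondegenerate
contact set every solution leaves the penetrating velocities within a simulation time
proportional to the norm of the initial velocity. -/
theorem mainTheorem1 {n m : ℕ} (N : ContactSet n m) :
    (N.Nondegenerate ↔ N.Dissipative) ∧
    (N.Nondegenerate →
      ∃ S : ℝ, 0 < S ∧ ∀ v : ℝ → Velocity n,
        IsSolution N.derivMap 0 (S * ‖v 0‖) v →
          ∃ s ∈ Set.Icc 0 (S * ‖v 0‖), v s ∉ N.penetrating) :=
  ⟨⟨fun h => h.dissipative, fun h => h.nondegenerate⟩, fun h => h.exists_exit_time⟩
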